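/- Let $\varepsilon>0$, $\lambda>\lambda_0:=3/2^{2/3}$, let $b>0$ satisfy $b^3-\lambda b-1>0$, and let $\alpha_0$ be the smallest root of $x^3-\lambda x+1=0$. Consider the equation $$\varepsilon^2u''=u^3-\lambda u+\cos t ,\qquad(*)$$ and for $\alpha\in\mathbb R$ let $u_\alpha$ be its solution with $u_\alpha(0)=\alpha$, $u_\alpha'(0)=0$. Suppose that there is an $\bar\alpha\in(\alpha_0,-\sqrt{\lambda/3})$ such that $u_{\bar\alpha}(t)$ increases monotonically as $t$ increases from $0$ and crosses $u=b$ at a time $T<\pi/2$. For $k\in\mathbb Z$ let $w_k$ be the restriction of $t\mapsto(-1)^ku_{\bar\alpha}(t-k\pi)$ to $[k\pi-T,k\pi+T]$ (the interval on which its absolute value is at most $b$). Let $f_+(t)=w_k(t)$ if $k$ is even and $|t-k\pi|\le T$, and $f_+(t)=b$ otherwise; let $f_-(t)=w_k(t)$ if $k$ is odd and $|t-k\pi|\le T$, and $f_-(t)=-b$ otherwise. Put $g_+=\max\{\sqrt{\lambda/3},f_-\}$ and $g_-=\min\{-\sqrt{\lambda/3},f_+\}$. Let $(\omega_k)_{k\ge1}$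 be any sequence in $\{1,2,3,4,5\}$ in which no $1$ or $2$ is immediately followed by a $4$ or $5$, and no $4$ or $5$ is immediately followed by a $1$ or $2$. Then $(*)$ has a solution $u$ on $(-\infty,\infty)$ with $u'(0)=0$ such that for every $k\ge1$: (i) if $\omega_k\in\{1,2\}$, then the graph of $u$ intersects $w_{2k-1}$ at exactly two points and does not intersect $w_{2k}$; (ii) if $\omega_k=1$, then $u<g_-$ in $((2k-2)\pi,2k\pi)$, while if $\omega_k=2$, then $u>g_-$ somewhere in this interval; (iii) if $\omega_k=3$, then the graph of $u$ intersects neither $w_{2k-1}$ nor $w_{2k}$; (iv) if $\omega_k\in\{4,5\}$, then the graph of $u$ does not intersect $w_{2k-1}$ and intersects $w_{2k}$ at exactly two points; (v) if $\omega_k=4$, then $u<g_+$ somewhere in $((2k-1)\pi,(2k+1)\pi)$, while if $\omega_k=5$, then $u>g_+$ throughout this interval. -/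

import Mathlib

namespace Duffing

/-- `u` is a (classical) solution of `ε² u'' = u³ - lam u + cos t` on the open set `s`. -/
def IsSolutionOn (ε lam : ℝ) (u : ℝ → ℝ) (s : Set ℝ) : Prop :=
  ∀ t ∈ s, DifferentiableAt ℝ u t ∧ DifferentiableAt ℝ (deriv u) t ∧
    ε ^ 2 * deriv (deriv u) t = u t ^ 3 - lam * u t + Real.cos t

/-- The critical parameter `λ₀ = 3 / 2^(2/3)`. -/
noncomputable def lam0 : ℝ := 3 / (2 : ℝ) ^ ((2 : ℝ) / 3)

/-- The smallest real root `α₀` of `x³ - lam x + 1 = 0`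
(the set is finite and non-empty, so the infimum is its least element). -/
noncomputable def alpha0 (lam : ℝ) : ℝ := sInf {x : ℝ | x ^ 3 - lam * x + 1 = 0}

/-- The shooting value `a` (written `ᾱ` in the literature) lies in `(α₀, -√(lam/3))`, and the
solution `v = u_a` with `v 0 = a`, `v' 0 = 0` increases strictly from `t = 0` until it crosses
the level `b`, at the time `T < π/2`.  The function `v` is prescribed only on an open interval
around `[-T, T]`, because `u_a` need not exist for all times; its values elsewhere are not used. -/
structure ConditionA (ε lam b a : ℝ) (v : ℝ → ℝ) (T : ℝ) : Prop where
  alpha0_lt : alpha0 lam < a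
  lt_neg_sqrt : a < -Real.sqrt (lam / 3)
  T_pos : 0 < T
  T_lt : T < Real.pi / 2
  isSolution : ∃ R, T < R ∧ IsSolutionOn ε lam v (Set.Ioo (-R) R)
  init : v 0 = a
  deriv_init : deriv v 0 = 0
  strictMono : StrictMonoOn v (Set.Icc 0 T)
  crosses : v T = b

/-- The translated (for odd `k` also reflected) solution `(-1)^k v(t - kπ)`. -/
noncomputable def spike (v : ℝ → ℝ) (k : ℤ) (t : ℝ) : ℝ :=
  (-1 : ℝ) ^ k * v (t - k * Real.pi)

/-- The interval `[s_k, S_k] = [kπ - T, kπ + T]` to which the `k`-th spike `w_k` is restricted;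
it is the interval on which `|(-1)^k v(t - kπ)| ≤ b`. -/
def spikeDom (T : ℝ) (k : ℤ) : Set ℝ := Set.Icc (k * Real.pi - T) (k * Real.pi + T)

/-- The times at which the graph of `u` meets the graph of `w_k`. -/
def meets (v : ℝ → ℝ) (T : ℝ) (u : ℝ → ℝ) (k : ℤ) : Set ℝ :=
  {t | t ∈ spikeDom T k ∧ u t = spike v k t}

open Classical in
/-- `f₊` is `w_k` on the domain of `w_k` for even `k`, and `b` elsewhere.  For `T < π/2` the
domains are pairwise disjoint, so the index `k` is unique. -/
noncomputable def fPlus (v : ℝ → ℝ) (T b t : ℝ) : ℝ :=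
  if h : ∃ k : ℤ, Even k ∧ t ∈ spikeDom T k then spike v h.choose t else b

open Classical in
/-- `f₋` is `w_k` on the domain of `w_k` for odd `k`, and `-b` elsewhere. -/
noncomputable def fMinus (v : ℝ → ℝ) (T b t : ℝ) : ℝ :=
  if h : ∃ k : ℤ, Odd k ∧ t ∈ spikeDom T k then spike v h.choose t else -b

/-- `g₊ = max {√(lam/3), f₋}`. -/
noncomputable def gPlus (lam : ℝ) (v : ℝ → ℝ) (T b t : ℝ) : ℝ :=
  max (Real.sqrt (lam / 3)) (fMinus v T b t)

/-- `g₋ = min {-√(lam/3), f₊}`. -/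
noncomputable def gMinus (lam : ℝ) (v : ℝ → ℝ) (T b t : ℝ) : ℝ :=
  min (-Real.sqrt (lam / 3)) (fPlus v T b t)

end Duffing

namespace Duffing

open Set Filter Topology

/-! The proof is a shooting argument in the initial value `α ∈ [-b, a]`, with zero initial velocity.
The cubic is frozen outside `[-b, b]`, so that all trajectories are global and depend continuously
on `α`; the trajectory finally chosen stays inside `(-b, b)`, where nothing was changed.

Two facts drive everything. Escape: beyond `±b` the acceleration points outwards, so a trajectory
starting at rest in `[-b, b]` that reaches `±b` at a later time never returns. Comparison
(`IsTraj.comparison`): a trajectory meeting the rising half of the spike `V` with at least its slope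
reaches `b` by time `T`; this follows from the energy `y²/2 - μΦ(x) - μ x cos t`, whose derivative
is `μ x sin t`. Hence a trajectory that never escapes crosses each half spike at most once,
transversally, and its number of intersections with `w_n` is 2 or 0 according as `(-1)^n u(nπ)` is
above or below `a`. The intersection conditions thus become inequalities at the times `nπ`.

An `Arc` at time `nπ` is an interval of parameters along which the reflected value runs from `-b` to
`a`. One end escapes downwards and the other, by comparison, upwards, both before time `(n+1)π`. By
the intermediate value theorem the arc contains an arc at a later time whose surviving members
behave as prescribed (`exists_arc_succ`, `exists_arc_below`, `exists_arc_above`). To control whether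
a trajectory rises above `-c`, with `c = √(lam/3)`, the cubic is replaced by `M`, frozen above its
local maximum at `-c`. As `lam > lam0` makes the maximum value exceed 1, `-c` is an escape level for
`M`, and a trajectory staying below `-c` is the same for both systems. Nested arcs following `ω`
have a common parameter, and its trajectory is the solution. -/

/-- `(x, y)` solves the first-order system `x' = y`, `y' = μ (N x + cos t)` at all times in `s`. -/
def IsTraj (μ : ℝ) (N : ℝ → ℝ) (s : Set ℝ) (x y : ℝ → ℝ) : Prop :=
  ∀ t ∈ s, HasDerivAt x (y t) t ∧ HasDerivAt y (μ * (N (x t) + Real.cos t)) t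

/-! ### Symmetries, uniqueness, global existence and continuous dependence -/

section Trajectories

variable {μ : ℝ} {N : ℝ → ℝ} {s : Set ℝ} {x y x₁ y₁ x₂ y₂ : ℝ → ℝ}

theorem IsTraj.mono {s' : Set ℝ} (h : IsTraj μ N s x y) (hs : s' ⊆ s) : IsTraj μ N s' x y :=
  fun t ht => h t (hs ht)

theorem IsTraj.congr_right {N' : ℝ → ℝ} (h : IsTraj μ N s x y) (hN : ∀ t ∈ s, N (x t) = N' (x t)) :
    IsTraj μ N' s x y :=
  fun t ht => ⟨(h t ht).1, hN t ht ▸ (h t ht).2⟩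

theorem IsTraj.comp_neg (h : IsTraj μ N s x y) :
    IsTraj μ N (-s) (fun t => x (-t)) (fun t => -y (-t)) := by
  intro t ht
  obtain ⟨h1, h2⟩ := h (-t) ht
  have hn : HasDerivAt (fun t : ℝ => -t) (-1) t := hasDerivAt_neg t
  refine ⟨?_, ?_⟩
  · exact (h1.comp t hn).congr_deriv (by ring)
  · exact (h2.comp t hn).neg.congr_deriv (by rw [Real.cos_neg]; ring)

/-- The reflected trajectory solves the system with the reflected nonlinearity. -/
theorem IsTraj.shift_neg_reflect (h : IsTraj μ N univ x y) : IsTraj μ (fun u => -N (-u)) univ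
    (fun t => -x (t + Real.pi)) (fun t => -y (t + Real.pi)) := by
  intro t _
  obtain ⟨h1, h2⟩ := h (t + Real.pi) trivial
  refine ⟨(h1.comp_add_const t Real.pi).neg, ?_⟩
  refine (h2.comp_add_const t Real.pi).neg.congr_deriv ?_
  simp only [Real.cos_add_pi, neg_neg]; ring

theorem IsTraj.shift_neg (hN : ∀ u, N (-u) = -N u) (h : IsTraj μ N univ x y) :
    IsTraj μ N univ (fun t => -x (t + Real.pi)) (fun t => -y (t + Real.pi)) :=
  h.shift_neg_reflect.congr_right fun t _ => by rw [hN, neg_neg]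

/-- The vector field of the first-order system. -/
noncomputable def field (μ : ℝ) (N : ℝ → ℝ) (t : ℝ) (z : ℝ × ℝ) : ℝ × ℝ :=
  (z.2, μ * (N z.1 + Real.cos t))

theorem IsTraj.hasDerivAt (h : IsTraj μ N s x y) {t : ℝ} (ht : t ∈ s) :
    HasDerivAt (fun t => (x t, y t)) (field μ N t (x t, y t)) t :=
  (h t ht).1.prodMk (h t ht).2

theorem field_lipschitz {K : NNReal} (hN : LipschitzWith K N) (t : ℝ) :
    LipschitzWith (max 1 (‖μ‖₊ * K)) (field μ N t) := by
  refine LipschitzWith.prodMk LipschitzWith.prod_snd ?_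
  refine LipschitzWith.of_dist_le_mul fun z w => ?_
  have h1 := (hN.comp LipschitzWith.prod_fst).dist_le_mul z w
  simp only [Function.comp, mul_one] at h1
  rw [Real.dist_eq] at h1 ⊢
  have : μ * (N z.1 + Real.cos t) - μ * (N w.1 + Real.cos t) = μ * (N z.1 - N w.1) := by ring
  rw [this, abs_mul]
  simpa [mul_assoc] using mul_le_mul_of_nonneg_left h1 (abs_nonneg μ)

theorem IsTraj.dist_le {K : NNReal} (hN : LipschitzWith K N) {S : ℝ}
    (h₁ : IsTraj μ N (Icc 0 S) x₁ y₁) (h₂ : IsTraj μ N (Icc 0 S) x₂ y₂) :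
    ∀ t ∈ Icc 0 S, dist (x₁ t, y₁ t) (x₂ t, y₂ t) ≤
      dist (x₁ 0, y₁ 0) (x₂ 0, y₂ 0) * Real.exp ((max 1 (‖μ‖₊ * K) : NNReal) * t) := by
  intro t ht
  have := dist_le_of_trajectories_ODE (v := field μ N) (f := fun t => (x₁ t, y₁ t))
    (g := fun t => (x₂ t, y₂ t)) (a := 0) (b := S) (fun t => field_lipschitz (μ := μ) hN t)
    (fun t ht => (h₁.hasDerivAt ht).continuousAt.continuousWithinAt)
    (fun t ht => (h₁.hasDerivAt (Ico_subset_Icc_self ht)).hasDerivWithinAt)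
    (fun t ht => (h₂.hasDerivAt ht).continuousAt.continuousWithinAt)
    (fun t ht => (h₂.hasDerivAt (Ico_subset_Icc_self ht)).hasDerivWithinAt) le_rfl t ht
  simpa using this

theorem IsTraj.eqOn {K : NNReal} (hN : LipschitzWith K N) {t₀ S : ℝ}
    (h₁ : IsTraj μ N (Icc t₀ S) x₁ y₁) (h₂ : IsTraj μ N (Icc t₀ S) x₂ y₂)
    (hx : x₁ t₀ = x₂ t₀) (hy : y₁ t₀ = y₂ t₀) :
    ∀ t ∈ Icc t₀ S, x₁ t = x₂ t ∧ y₁ t = y₂ t := by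
  intro t ht
  have := ODE_solution_unique (v := field μ N) (f := fun t => (x₁ t, y₁ t))
    (g := fun t => (x₂ t, y₂ t)) (a := t₀) (b := S) (fun t => field_lipschitz (μ := μ) hN t)
    (fun t ht => (h₁.hasDerivAt ht).continuousAt.continuousWithinAt)
    (fun t ht => (h₁.hasDerivAt (Ico_subset_Icc_self ht)).hasDerivWithinAt)
    (fun t ht => (h₂.hasDerivAt ht).continuousAt.continuousWithinAt)
    (fun t ht => (h₂.hasDerivAt (Ico_subset_Icc_self ht)).hasDerivWithinAt) (by simp [hx, hy]) ht
  simpa using this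

theorem IsTraj.eq_of_zero {K : NNReal} (hN : LipschitzWith K N)
    (h₁ : IsTraj μ N univ x₁ y₁) (h₂ : IsTraj μ N univ x₂ y₂)
    (hx : x₁ 0 = x₂ 0) (hy : y₁ 0 = y₂ 0) (t : ℝ) : x₁ t = x₂ t ∧ y₁ t = y₂ t := by
  rcases le_total 0 t with ht | ht
  · exact (h₁.mono (subset_univ _)).eqOn hN (h₂.mono (subset_univ _)) hx hy t ⟨ht, le_rfl⟩
  · have := (h₁.comp_neg.mono (s' := Icc 0 (-t)) (by simp)).eqOn hN
      (h₂.comp_neg.mono (by simp)) (by simpa using hx) (by simpa using hy) (-t)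
      ⟨by linarith, le_rfl⟩
    simpa using this

theorem IsTraj.even {K : NNReal} (hN : LipschitzWith K N) (h : IsTraj μ N univ x y)
    (hy : y 0 = 0) (t : ℝ) : x (-t) = x t ∧ y (-t) = -y t := by
  have := h.eq_of_zero hN (h.comp_neg.mono (s' := univ) (by simp)) (by simp) (by simp [hy]) (-t)
  simpa using this

/-- The restriction of the real line to `[l, r]`. -/
noncomputable def clamp (l r x : ℝ) : ℝ := max l (min x r)

theorem lipschitz_clamp (l r : ℝ) : LipschitzWith 1 (clamp l r) :=
  (LipschitzWith.id.min_const r).const_max l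

theorem clamp_mem {l r : ℝ} (h : l ≤ r) (x : ℝ) : clamp l r x ∈ Icc l r :=
  ⟨le_max_left _ _, max_le h (min_le_right _ _)⟩

theorem clamp_of_mem {l r x : ℝ} (h : x ∈ Icc l r) : clamp l r x = x := by
  simp [clamp, h.1, h.2]

theorem clamp_of_ge {l r x : ℝ} (hl : l ≤ r) (h : r ≤ x) : clamp l r x = r := by
  simp [clamp, h, hl]

/-- Trajectories exist on every compact interval when the nonlinearity is bounded. -/
theorem exists_isTraj_Ioo {K : NNReal} (hN : LipschitzWith K N) {B : ℝ} (hB : ∀ u, |N u| ≤ B)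
    (x₀ y₀ : ℝ) {S : ℝ} (hS : 0 < S) :
    ∃ x y, IsTraj μ N (Ioo (-S) S) x y ∧ x 0 = x₀ ∧ y 0 = y₀ := by
  have hB0 : 0 ≤ B := (abs_nonneg _).trans (hB 0)
  set A : ℝ := |μ| * (B + 1) with hA
  have hA0 : 0 ≤ A := by positivity
  -- `R` is an a priori bound for `|y|` on `(-S, S)`. Clamping the velocity at `R` makes the field
  -- bounded, as Picard–Lindelöf needs here, and the bound then shows that the clamp is inactive.
  set R : ℝ := |y₀| + A * S with hR
  have hR0 : 0 ≤ R := by positivity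
  set L : NNReal := ⟨max R A, le_max_of_le_left hR0⟩ with hL
  have hacc : ∀ t u, |μ * (N u + Real.cos t)| ≤ A := by
    intro t u
    rw [abs_mul]
    refine mul_le_mul_of_nonneg_left ?_ (abs_nonneg μ)
    exact (abs_add_le _ _).trans (add_le_add (hB u) (Real.abs_cos_le_one t))
  let f : ℝ → ℝ × ℝ → ℝ × ℝ := fun t z => field μ N t (z.1, clamp (-R) R z.2)
  have hlip : ∀ t, LipschitzWith (max 1 (‖μ‖₊ * K)) (f t) := by
    intro t
    have h2 : LipschitzWith 1 (fun z : ℝ × ℝ => (z.1, clamp (-R) R z.2)) := by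
      have := LipschitzWith.prod_fst.prodMk
        ((lipschitz_clamp (-R) R).comp (LipschitzWith.prod_snd (α := ℝ) (β := ℝ)))
      simpa using this
    have := (field_lipschitz (μ := μ) hN t).comp h2
    rwa [mul_one] at this
  have hpl : IsPicardLindelof f (tmin := -S) (tmax := S) ⟨0, by constructor <;> linarith⟩ (x₀, y₀)
      (L * S.toNNReal) 0 L (max 1 (‖μ‖₊ * K)) := by
    refine ⟨fun t _ => (hlip t).lipschitzOnWith, fun z _ => ?_, fun t _ z _ => ?_, ?_⟩
    · apply Continuous.continuousOn
      simp only [f, field]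
      fun_prop
    · simp only [f, field, Prod.norm_def, Real.norm_eq_abs]
      have hc := clamp_mem (l := -R) (r := R) (by linarith) z.2
      exact max_le ((abs_le.2 hc).trans (le_max_left _ _)) ((hacc _ _).trans (le_max_right _ _))
    · simp only [sub_zero, zero_sub, neg_neg, max_self]
      rw [NNReal.coe_zero, sub_zero, NNReal.coe_mul, Real.coe_toNNReal S hS.le]
  obtain ⟨z, hz0, hz⟩ := hpl.exists_eq_forall_mem_Icc_hasDerivWithinAt₀
  have hz' : ∀ t ∈ Ioo (-S) S, HasDerivAt z (f t (z t)) t := fun t ht =>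
    (hz t (Ioo_subset_Icc_self ht)).hasDerivAt (Icc_mem_nhds ht.1 ht.2)
  have hy : ∀ t ∈ Ioo (-S) S,
      HasDerivAt (fun t => (z t).2) (μ * (N (z t).1 + Real.cos t)) t := fun t ht =>
    (hz' t ht).snd
  have hyb : ∀ t ∈ Ioo (-S) S, (z t).2 ∈ Icc (-R) R := by
    intro t ht
    have h0 : (0 : ℝ) ∈ Ioo (-S) S := ⟨by linarith, hS⟩
    have := (convex_Ioo (-S) S).norm_image_sub_le_of_norm_hasDerivWithin_le
      (fun t ht => (hy t ht).hasDerivWithinAt) (fun t _ => hacc t (z t).1) h0 ht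
    have hz0' : (z 0).2 = y₀ := by simpa using congrArg Prod.snd hz0
    simp only [Real.norm_eq_abs, sub_zero, hz0'] at this
    have ht' : |t| ≤ S := (abs_lt.2 ht).le
    have h3 : |(z t).2| ≤ R := by
      calc |(z t).2| = |((z t).2 - y₀) + y₀| := by ring_nf
        _ ≤ |(z t).2 - y₀| + |y₀| := abs_add_le _ _
        _ ≤ A * S + |y₀| := by gcongr; exact this.trans (by gcongr)
        _ = R := by rw [hR]; ring
    exact abs_le.1 h3
  refine ⟨fun t => (z t).1, fun t => (z t).2, fun t ht => ⟨?_, hy t ht⟩, ?_, ?_⟩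
  · have h1 : HasDerivAt (fun t => (z t).1) (f t (z t)).1 t := (hz' t ht).fst
    refine h1.congr_deriv ?_
    simp [f, field, clamp_of_mem (hyb t ht)]
  · simpa using congrArg Prod.fst hz0
  · simpa using congrArg Prod.snd hz0

theorem exists_isTraj {K : NNReal} (hN : LipschitzWith K N) {B : ℝ} (hB : ∀ u, |N u| ≤ B)
    (x₀ y₀ : ℝ) : ∃ x y, IsTraj μ N univ x y ∧ x 0 = x₀ ∧ y 0 = y₀ := by
  choose X Y h h0 h0' using fun n : ℕ =>
    exists_isTraj_Ioo (μ := μ) hN hB x₀ y₀ (S := n + 1) (by positivity)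
  have key : ∀ m n : ℕ, ∀ t : ℝ, |t| < m + 1 → |t| < n + 1 → X m t = X n t ∧ Y m t = Y n t := by
    intro m n t hm hn
    rw [abs_lt] at hm hn
    rcases le_total 0 t with ht | ht
    · exact ((h m).mono (fun s hs => ⟨by linarith [hs.1], by linarith [hs.2]⟩)).eqOn hN
        ((h n).mono (fun s hs => ⟨by linarith [hs.1], by linarith [hs.2]⟩))
        ((h0 m).trans (h0 n).symm) ((h0' m).trans (h0' n).symm) t ⟨ht, le_rfl⟩
    · have := ((h m).comp_neg.mono (s' := Icc 0 (-t)) (fun s hs =>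
          ⟨by linarith [hs.2], by linarith [hs.1]⟩)).eqOn hN
        ((h n).comp_neg.mono (fun s hs => ⟨by linarith [hs.2], by linarith [hs.1]⟩))
        (by simp [h0]) (by simp [h0']) (-t) ⟨by linarith, le_rfl⟩
      simpa using this
  refine ⟨fun t => X ⌈|t|⌉₊ t, fun t => Y ⌈|t|⌉₊ t, fun t _ => ?_, h0 _, h0' _⟩
  -- The ceiling may jump at `t`; the fixed index `m` serves a whole neighbourhood of `t`.
  set m := ⌈|t|⌉₊ + 1 with hm
  have hlt : |t| < m := by
    have := Nat.le_ceil |t|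
    push_cast [hm]; linarith
  have hev : ∀ᶠ s in 𝓝 t, X ⌈|s|⌉₊ s = X m s ∧ Y ⌈|s|⌉₊ s = Y m s := by
    have : ∀ᶠ s : ℝ in 𝓝 t, |s| < m := (continuous_abs.tendsto t).eventually (gt_mem_nhds hlt)
    filter_upwards [this] with s hs
    exact key _ _ s (by have := Nat.le_ceil |s|; linarith) (by linarith)
  obtain ⟨h1, h2⟩ := h m t (by rw [mem_Ioo, ← abs_lt]; linarith)
  beta_reduce
  rw [hev.self_of_nhds.1, hev.self_of_nhds.2]
  exact ⟨h1.congr_of_eventuallyEq (hev.mono fun _ hs => hs.1),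
    h2.congr_of_eventuallyEq (hev.mono fun _ hs => hs.2)⟩

/-- Trajectories depend continuously on a parameter if their Cauchy data do. -/
theorem continuousOn_traj {K : NNReal} (hN : LipschitzWith K N) {X Y : ℝ → ℝ → ℝ} {s : Set ℝ}
    (h : ∀ α, IsTraj μ N univ (X α) (Y α)) (hX : ContinuousOn (fun α => X α 0) s)
    (hY : ContinuousOn (fun α => Y α 0) s) {t : ℝ} (ht : 0 ≤ t) :
    ContinuousOn (fun α => X α t) s ∧ ContinuousOn (fun α => Y α t) s := by
  have key : ContinuousOn (fun α => (X α t, Y α t)) s := by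
    intro α hα
    have h0 : ContinuousWithinAt (fun α => (X α 0, Y α 0)) s α := (hX α hα).prodMk (hY α hα)
    rw [ContinuousWithinAt, tendsto_iff_dist_tendsto_zero] at h0 ⊢
    have := h0.mul_const (Real.exp ((max 1 (‖μ‖₊ * K) : NNReal) * t))
    rw [zero_mul] at this
    exact squeeze_zero (fun _ => dist_nonneg) (fun β =>
      ((h β).mono (subset_univ _)).dist_le hN ((h α).mono (subset_univ _)) t ⟨ht, le_rfl⟩) this
  exact ⟨continuous_fst.comp_continuousOn key, continuous_snd.comp_continuousOn key⟩

end Trajectories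

/-! ### One-sided sign lemmas and first hitting times -/

section RealAnalysis

theorem eventually_gt_of_hasDerivAt_pos {f : ℝ → ℝ} {f' t : ℝ} (h : HasDerivAt f f' t)
    (hf : 0 < f') : ∀ᶠ s in 𝓝[>] t, f t < f s := by
  have h1 := (hasDerivAt_iff_tendsto_slope.1 h).eventually (lt_mem_nhds hf)
  have h2 : ∀ᶠ s in 𝓝[>] t, 0 < slope f t s :=
    nhdsWithin_mono t (fun s (hs : t < s) => ne_of_gt hs) h1
  filter_upwards [h2, self_mem_nhdsWithin] with s hs hts
  rw [slope_def_field, div_pos_iff_of_pos_right (sub_pos.2 hts)] at hs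
  linarith

theorem eventually_lt_of_hasDerivAt_neg {f : ℝ → ℝ} {f' t : ℝ} (h : HasDerivAt f f' t)
    (hf : f' < 0) : ∀ᶠ s in 𝓝[>] t, f s < f t :=
  (eventually_gt_of_hasDerivAt_pos h.neg (by linarith)).mono fun s hs => by
    simpa using hs

theorem eventually_left_gt_of_hasDerivAt_neg {f : ℝ → ℝ} {f' t : ℝ} (h : HasDerivAt f f' t)
    (hf : f' < 0) : ∀ᶠ s in 𝓝[<] t, f t < f s := by
  have h1 := (hasDerivAt_iff_tendsto_slope.1 h).eventually (gt_mem_nhds hf)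
  have h2 : ∀ᶠ s in 𝓝[<] t, slope f t s < 0 :=
    nhdsWithin_mono t (fun s (hs : s < t) => ne_of_lt hs) h1
  filter_upwards [h2, self_mem_nhdsWithin] with s hs hts
  rw [slope_def_field, div_neg_iff] at hs
  have : s < t := hts
  rcases hs with hs | hs <;> linarith

theorem exists_first_hit {g : ℝ → ℝ} {p q r : ℝ} (hpq : p ≤ q) (hg : ContinuousOn g (Icc p q))
    (hp : g p < r) (hq : r ≤ g q) :
    ∃ c ∈ Ioc p q, g c = r ∧ ∀ x ∈ Ico p c, g x < r := by
  have hcl : IsClosed (Icc p q ∩ g ⁻¹' Ici r) := hg.preimage_isClosed_of_isClosed isClosed_Icc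
    isClosed_Ici
  have hcpt : IsCompact (Icc p q ∩ g ⁻¹' Ici r) :=
    isCompact_Icc.of_isClosed_subset hcl inter_subset_left
  obtain ⟨c, hc, hmin⟩ := hcpt.exists_isLeast ⟨q, ⟨hpq, le_rfl⟩, hq⟩
  have hlt : ∀ x ∈ Ico p c, g x < r := by
    intro x hx
    by_contra h
    exact absurd (hmin ⟨⟨hx.1, hx.2.le.trans hc.1.2⟩, not_lt.1 h⟩) (not_le.2 hx.2)
  refine ⟨c, ⟨lt_of_le_of_ne hc.1.1 ?_, hc.1.2⟩, le_antisymm ?_ hc.2, hlt⟩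
  · rintro rfl
    exact absurd hc.2 (not_le.2 hp)
  · obtain ⟨x, hx, hxr⟩ := intermediate_value_Icc hc.1.1
      (hg.mono (Icc_subset_Icc_right hc.1.2)) ⟨hp.le, hc.2⟩
    rcases hx.2.eq_or_lt with rfl | h
    · exact hxr.le
    · exact absurd hxr (hlt x ⟨hx.1, h⟩).ne

/-- A function whose derivative is negative at each of its zeros stays negative once it is
non-positive. -/
theorem neg_of_deriv_neg_at_zeros {d d' : ℝ → ℝ} {s t : ℝ}
    (hd : ∀ τ ∈ Icc s t, HasDerivAt d (d' τ) τ) (hz : ∀ τ ∈ Icc s t, d τ = 0 → d' τ < 0)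
    (hs : d s ≤ 0) (hst : s < t) : d t < 0 := by
  by_contra ht
  obtain ⟨σ, hσ, hσt, hdσ⟩ : ∃ σ, s ≤ σ ∧ σ < t ∧ d σ < 0 := by
    rcases hs.eq_or_lt with h | h
    · have h1 := eventually_lt_of_hasDerivAt_neg (hd s ⟨le_rfl, hst.le⟩)
        (hz s ⟨le_rfl, hst.le⟩ h)
      obtain ⟨σ, h2, h3⟩ := (h1.and (Ioo_mem_nhdsGT hst)).exists
      exact ⟨σ, h3.1.le, h3.2, by linarith⟩
    · exact ⟨s, le_rfl, hst, h⟩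
  have hsub : Icc σ t ⊆ Icc s t := Icc_subset_Icc_left hσ
  obtain ⟨c, hc, hc0, hlt⟩ := exists_first_hit hσt.le
    (fun τ hτ => (hd τ (hsub hτ)).continuousAt.continuousWithinAt) hdσ (not_lt.1 ht)
  have hcs : c ∈ Icc s t := hsub (Ioc_subset_Icc_self hc)
  have h1 := eventually_left_gt_of_hasDerivAt_neg (hd c hcs) (hz c hcs hc0)
  obtain ⟨τ, h2, h3⟩ := (h1.and (Ioo_mem_nhdsLT hc.1)).exists
  have := hlt τ ⟨h3.1.le, h3.2⟩
  linarith

end RealAnalysis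

/-! ### Escape beyond a level where the nonlinearity dominates the forcing -/

section Escape

variable {μ r : ℝ} {N : ℝ → ℝ} {x y : ℝ → ℝ}

theorem IsTraj.continuous_fst (h : IsTraj μ N univ x y) : Continuous x :=
  continuous_iff_continuousAt.2 fun t => (h t trivial).1.continuousAt

theorem IsTraj.continuous_snd (h : IsTraj μ N univ x y) : Continuous y :=
  continuous_iff_continuousAt.2 fun t => (h t trivial).2.continuousAt

/-- Above a level where the nonlinearity exceeds `1`, a trajectory moving upwards keeps rising. -/
theorem IsTraj.escape (hμ : 0 < μ) (hN : ∀ u, r ≤ u → 1 < N u) (h : IsTraj μ N univ x y)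
    {t₀ : ℝ} (hx : r ≤ x t₀) (hy : 0 ≤ y t₀) {t : ℝ} (ht : t₀ < t) : r < x t := by
  have hacc : ∀ s, r ≤ x s → 0 < μ * (N (x s) + Real.cos s) := fun s hs =>
    mul_pos hμ (by linarith [hN _ hs, Real.neg_one_le_cos s])
  have hmon : ∀ {s s' : ℝ}, s < s' → (∀ τ ∈ Ioo s s', 0 < y τ) → x s < x s' := by
    intro s s' hss hp
    refine strictMonoOn_of_deriv_pos (convex_Icc s s') h.continuous_fst.continuousOn ?_
      ⟨le_rfl, hss.le⟩ ⟨hss.le, le_rfl⟩ hss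
    intro τ hτ
    rw [interior_Icc] at hτ
    rw [(h τ trivial).1.deriv]
    exact hp τ hτ
  -- Continuous induction: the conditions are closed, and where they hold the acceleration is
  -- positive, so they persist a little to the right.
  have key : Icc t₀ t ⊆ {s | r ≤ x s ∧ 0 ≤ y s} := by
    refine IsClosed.Icc_subset_of_forall_exists_gt ?_ ⟨hx, hy⟩ ?_
    · exact ((isClosed_le continuous_const h.continuous_fst).inter
        (isClosed_le continuous_const h.continuous_snd)).inter isClosed_Icc
    · rintro s ⟨⟨hs1, hs2⟩, -⟩ z hz
      have hev := eventually_gt_of_hasDerivAt_pos (h s trivial).2 (hacc s hs1)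
      obtain ⟨w, hw, hsub⟩ := (mem_nhdsGT_iff_exists_Ioc_subset).1 hev
      have hm : s < min w z := lt_min hw hz
      have hpos : ∀ τ ∈ Ioc s (min w z), 0 < y τ := fun τ hτ =>
        hs2.trans_lt (hsub ⟨hτ.1, hτ.2.trans (min_le_left _ _)⟩)
      exact ⟨min w z, ⟨hs1.trans (hmon hm fun τ hτ => hpos τ (Ioo_subset_Ioc_self hτ)).le,
        (hpos _ ⟨hm, le_rfl⟩).le⟩, hm, min_le_right _ _⟩
  have hy' : StrictMonoOn y (Icc t₀ t) := by
    refine strictMonoOn_of_deriv_pos (convex_Icc _ _) h.continuous_snd.continuousOn ?_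
    intro τ hτ
    rw [interior_Icc] at hτ
    rw [(h τ trivial).2.deriv]
    exact hacc τ (key (Ioo_subset_Icc_self hτ)).1
  exact hx.trans_lt (hmon ht fun τ hτ =>
    hy.trans_lt (hy' ⟨le_rfl, ht.le⟩ (Ioo_subset_Icc_self hτ) hτ.1))

/-- A trajectory that starts below the level `r` and reaches it stays above it afterwards. -/
theorem IsTraj.escape_of_le (hμ : 0 < μ) (hN : ∀ u, r ≤ u → 1 < N u) (h : IsTraj μ N univ x y)
    {t₀ : ℝ} (hx : x t₀ ≤ r) (hy : x t₀ = r → 0 ≤ y t₀) {t : ℝ} (h0t : t₀ ≤ t) (ht : r ≤ x t)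
    {s : ℝ} (hts : t < s) : r < x s := by
  rcases hx.eq_or_lt with h0 | h0
  · exact h.escape hμ hN h0.ge (hy h0) (h0t.trans_lt hts)
  · obtain ⟨c, hc, hcr, hlt⟩ := exists_first_hit h0t h.continuous_fst.continuousOn h0 ht
    refine h.escape hμ hN hcr.ge ?_ (hc.2.trans_lt hts)
    by_contra hneg
    have h1 := eventually_left_gt_of_hasDerivAt_neg (h c trivial).1 (not_le.1 hneg)
    obtain ⟨τ, h2, h3⟩ := (h1.and (Ioo_mem_nhdsLT hc.1)).exists
    have := hlt τ ⟨h3.1.le, h3.2⟩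
    linarith

end Escape

/-! ### Energy comparison with the spike -/

section Comparison

variable {μ b T : ℝ} {N V V' x y : ℝ → ℝ}

/-- Only the explicit time dependence of `cos t` contributes to the derivative, which makes the
energies of two ordered trajectories comparable while `sin t ≥ 0`. -/
theorem IsTraj.hasDerivAt_energy {Φ : ℝ → ℝ} (hΦ : ∀ u, HasDerivAt Φ (N u) u)
    (h : IsTraj μ N univ x y) (t : ℝ) :
    HasDerivAt (fun t => y t ^ 2 / 2 - μ * Φ (x t) - μ * x t * Real.cos t)
      (μ * x t * Real.sin t) t := by
  obtain ⟨h1, h2⟩ := h t trivial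
  have h3 : HasDerivAt (fun t => Φ (x t)) (N (x t) * y t) t := (hΦ (x t)).comp t h1
  refine ((((h2.pow 2).div_const 2).sub (h3.const_mul μ)).sub
    ((h1.const_mul μ).mul (Real.hasDerivAt_cos t))).congr_deriv ?_
  push_cast
  ring

/-- Let `V` increase to the escape level `b` on `[0, T]`. A trajectory that meets `V` with at least
the slope of `V` has reached the level `b` by time `T`. -/
theorem IsTraj.comparison {K : NNReal} (hμ : 0 < μ) (hN : LipschitzWith K N)
    (hNb : ∀ u, b ≤ u → 1 < N u) (hV : IsTraj μ N univ V V') (hT : T ≤ Real.pi)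
    (hmono : StrictMonoOn V (Icc 0 T)) (hVT : V T = b) (h : IsTraj μ N univ x y) {t₀ : ℝ}
    (ht₀ : t₀ ∈ Icc 0 T) (hx : x t₀ = V t₀) (hy : V' t₀ ≤ y t₀) : b ≤ x T := by
  rcases hy.eq_or_lt with hy | hy
  · have := (h.mono (subset_univ (Icc t₀ T))).eqOn hN (hV.mono (subset_univ _)) hx hy.symm T
      ⟨ht₀.2, le_rfl⟩
    rw [this.1, hVT]
  by_contra hxT
  rw [not_le] at hxT
  have ht₀T : t₀ < T := by
    refine lt_of_le_of_ne ht₀.2 ?_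
    rintro rfl
    linarith
  have hV'0 : ∀ t ∈ Ico 0 T, 0 ≤ V' t := by
    intro t ht
    by_contra hneg
    have h1 := eventually_lt_of_hasDerivAt_neg (hV t trivial).1 (not_le.1 hneg)
    obtain ⟨τ, h2, h3⟩ := (h1.and (Ioo_mem_nhdsGT ht.2)).exists
    exact absurd (hmono (Ico_subset_Icc_self ht) ⟨ht.1.trans h3.1.le, h3.2.le⟩ h3.1) (not_lt.2 h2.le)
  have hy0 : 0 < y t₀ := (hV'0 t₀ ⟨ht₀.1, ht₀T⟩).trans_lt hy
  have hxb : ∀ t ∈ Ico t₀ T, x t < b := by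
    intro t ht
    by_contra hge
    have hle : x t₀ ≤ b := by
      rw [hx, ← hVT]
      exact hmono.monotoneOn ht₀ ⟨ht₀.1.trans ht₀.2, le_rfl⟩ ht₀.2
    have := h.escape_of_le hμ hNb hle (fun _ => hy0.le) ht.1 (not_lt.1 hge) ht.2
    linarith
  obtain ⟨Φ, hΦ⟩ : ∃ Φ : ℝ → ℝ, ∀ u, HasDerivAt Φ (N u) u :=
    ⟨fun u => ∫ s in (0 : ℝ)..u, N s, fun u => hN.continuous.integral_hasStrictDerivAt 0 u
      |>.hasDerivAt⟩
  have hd : ∀ t, HasDerivAt (fun t => V t - x t) (V' t - y t) t := fun t =>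
    (hV t trivial).1.sub (h t trivial).1
  -- the first return time
  obtain ⟨σ, hσ, hσd⟩ : ∃ σ ∈ Ioo t₀ T, ∀ t ∈ Ioc t₀ σ, V t - x t < 0 := by
    have h1 := eventually_lt_of_hasDerivAt_neg (hd t₀) (by linarith)
    obtain ⟨w, hw, hsub⟩ := (mem_nhdsGT_iff_exists_Ioc_subset).1 h1
    obtain ⟨σ, hσ1, hσ2⟩ := exists_between (lt_min hw ht₀T)
    refine ⟨σ, ⟨hσ1, hσ2.trans_le (min_le_right _ _)⟩, fun t ht => ?_⟩
    have : V t - x t < V t₀ - x t₀ := hsub ⟨ht.1, ht.2.trans (hσ2.le.trans (min_le_left _ _))⟩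
    linarith
  have hcd : Continuous fun t => V t - x t := hV.continuous_fst.sub h.continuous_fst
  obtain ⟨t₁, ht₁, ht₁0, hlt⟩ := exists_first_hit hσ.2.le hcd.continuousOn
    (hσd σ ⟨hσ.1, le_rfl⟩) (show 0 ≤ V T - x T by linarith)
  have ht₀₁ : t₀ < t₁ := hσ.1.trans ht₁.1
  have ht₁T : t₁ < T := by
    refine lt_of_le_of_ne ht₁.2 ?_
    rintro rfl
    linarith
  have hneg : ∀ t ∈ Ioo t₀ t₁, V t - x t < 0 := by
    intro t ht
    rcases le_total t σ with h1 | h1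
    · exact hσd t ⟨ht.1, h1⟩
    · exact hlt t ⟨h1, ht.2⟩
  have hle : ∀ t ∈ Icc t₀ t₁, V t ≤ x t := by
    intro t ht
    rcases ht.1.eq_or_lt with rfl | h1
    · exact hx.ge
    rcases ht.2.eq_or_lt with rfl | h2
    · linarith
    · linarith [hneg t ⟨h1, h2⟩]
  have hsin : ∀ t ∈ Icc 0 T, 0 ≤ Real.sin t := fun t ht =>
    Real.sin_nonneg_of_nonneg_of_le_pi ht.1 (ht.2.trans hT)
  have hEx := h.hasDerivAt_energy hΦ
  have hEV := hV.hasDerivAt_energy hΦ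
  -- Velocities are compared at equal heights: `V` reaches the height `x t₂` at a later time `t₃`.
  -- Up to `t₂` the energy gap between `x` and `V` grows because `x ≥ V`. From `t₂` to `t₃` the
  -- energy of `V`, corrected by `μ x(t₂) cos t`, decreases because `V` stays below `x t₂`. The
  -- potential terms then cancel.
  have hcomp : ∀ t₂ ∈ Icc t₀ t₁, ∃ t₃ ∈ Icc t₂ T, V t₃ = x t₂ ∧ V' t₃ ^ 2 < y t₂ ^ 2 := by
    intro t₂ ht₂
    have ht₂0 : 0 ≤ t₂ := ht₀.1.trans ht₂.1
    have ht₂T : t₂ < T := ht₂.2.trans_lt ht₁T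
    obtain ⟨t₃, ht₃, ht₃x⟩ := intermediate_value_Icc ht₂T.le hV.continuous_fst.continuousOn
      ⟨hle t₂ ht₂, by rw [hVT]; exact (hxb t₂ ⟨ht₂.1, ht₂T⟩).le⟩
    refine ⟨t₃, ht₃, ht₃x, ?_⟩
    have hD : MonotoneOn (fun t => (y t ^ 2 / 2 - μ * Φ (x t) - μ * x t * Real.cos t) -
        (V' t ^ 2 / 2 - μ * Φ (V t) - μ * V t * Real.cos t)) (Icc t₀ t₂) := by
      refine monotoneOn_of_deriv_nonneg (convex_Icc _ _)
        (fun t _ => ((hEx t).sub (hEV t)).continuousAt.continuousWithinAt)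
        (fun t _ => ((hEx t).sub (hEV t)).differentiableAt.differentiableWithinAt) ?_
      intro t ht
      rw [interior_Icc] at ht
      have e : deriv (fun t => (y t ^ 2 / 2 - μ * Φ (x t) - μ * x t * Real.cos t) -
        (V' t ^ 2 / 2 - μ * Φ (V t) - μ * V t * Real.cos t)) t = _ := ((hEx t).sub (hEV t)).deriv
      rw [e]
      have h1 := hle t ⟨ht.1.le, ht.2.le.trans ht₂.2⟩
      have h2 := hsin t ⟨ht₀.1.trans ht.1.le, ht.2.le.trans ht₂T.le⟩
      have : 0 ≤ μ * (x t - V t) * Real.sin t :=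
        mul_nonneg (mul_nonneg hμ.le (by linarith)) h2
      linarith
    have hA : AntitoneOn (fun t => (V' t ^ 2 / 2 - μ * Φ (V t) - μ * V t * Real.cos t) +
        μ * x t₂ * Real.cos t) (Icc t₂ t₃) := by
      have hder : ∀ t, HasDerivAt (fun t => (V' t ^ 2 / 2 - μ * Φ (V t) - μ * V t * Real.cos t) +
        μ * x t₂ * Real.cos t) (μ * V t * Real.sin t + μ * x t₂ * (-Real.sin t)) t := fun t =>
        (hEV t).add ((Real.hasDerivAt_cos t).const_mul _)
      refine antitoneOn_of_deriv_nonpos (convex_Icc _ _)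
        (fun t _ => (hder t).continuousAt.continuousWithinAt)
        (fun t _ => (hder t).differentiableAt.differentiableWithinAt) ?_
      intro t ht
      rw [interior_Icc] at ht
      rw [(hder t).deriv]
      have h0 : t ∈ Icc 0 T := ⟨ht₂0.trans ht.1.le, ht.2.le.trans ht₃.2⟩
      have h1 : V t ≤ V t₃ := hmono.monotoneOn h0 ⟨ht₂0.trans ht₃.1, ht₃.2⟩ ht.2.le
      have : 0 ≤ μ * (x t₂ - V t) * Real.sin t :=
        mul_nonneg (mul_nonneg hμ.le (by linarith)) (hsin t h0)
      linarith
    have e1 := hD ⟨le_rfl, ht₂.1⟩ ⟨ht₂.1, le_rfl⟩ ht₂.1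
    have e2 := hA ⟨le_rfl, ht₃.1⟩ ⟨ht₃.1, le_rfl⟩ ht₃.1
    simp only [ht₃x, hx] at e1 e2
    have e3 : V' t₀ ^ 2 < y t₀ ^ 2 :=
      pow_lt_pow_left₀ hy (hV'0 t₀ ⟨ht₀.1, ht₀T⟩) two_ne_zero
    linarith
  -- The strict inequality `V'² < y²` prevents `y` from vanishing before the return.
  have hypos : 0 < y t₁ := by
    by_contra hny
    obtain ⟨t₂, ht₂, hz⟩ := intermediate_value_Icc' ht₀₁.le h.continuous_snd.continuousOn
      ⟨not_lt.1 hny, hy0.le⟩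
    obtain ⟨t₃, -, -, h3⟩ := hcomp t₂ ht₂
    rw [hz] at h3
    nlinarith [sq_nonneg (V' t₃)]
  obtain ⟨t₃, ht₃, hVt₃, hlt₃⟩ := hcomp t₁ ⟨ht₀₁.le, le_rfl⟩
  have h10 : 0 ≤ t₁ := ht₀.1.trans ht₀₁.le
  -- At the return time the heights agree, so `x` is faster than `V` there, although `V` must catch
  -- up from below.
  have ht₃₁ : t₃ = t₁ := by
    refine hmono.injOn ⟨h10.trans ht₃.1, ht₃.2⟩ ⟨h10, ht₁T.le⟩ ?_
    linarith
  rw [ht₃₁] at hlt₃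
  have hlt' : V' t₁ < y t₁ := lt_of_pow_lt_pow_left₀ 2 hypos.le hlt₃
  have h1 := eventually_left_gt_of_hasDerivAt_neg (hd t₁) (by linarith)
  obtain ⟨τ, h2, h3⟩ := (h1.and (Ioo_mem_nhdsLT ht₀₁)).exists
  linarith [hneg τ h3]

end Comparison

/-! ### Crossings on unordered intervals -/

section Hitting

theorem exists_first_hit_uIcc {g : ℝ → ℝ} (hg : Continuous g) {p q r : ℝ} (hp : g p < r)
    (hq : r ≤ g q) : ∃ c ∈ uIcc p q, g c = r ∧ ∀ x ∈ uIcc p c, x ≠ c → g x < r := by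
  rcases le_total p q with h | h
  · obtain ⟨c, hc, hcr, hlt⟩ := exists_first_hit h hg.continuousOn hp hq
    refine ⟨c, by rw [uIcc_of_le h]; exact Ioc_subset_Icc_self hc, hcr, fun x hx hxc => ?_⟩
    rw [uIcc_of_le hc.1.le] at hx
    exact hlt x ⟨hx.1, lt_of_le_of_ne hx.2 hxc⟩
  · obtain ⟨c, hc, hcr, hlt⟩ := exists_first_hit (g := fun x => g (-x)) (p := -p) (q := -q)
      (neg_le_neg h) (hg.comp continuous_neg).continuousOn (by simpa using hp) (by simpa using hq)
    refine ⟨-c, ?_, hcr, fun x hx hxc => ?_⟩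
    · rw [uIcc_of_ge h]
      exact ⟨by linarith [hc.2], by linarith [hc.1]⟩
    · rw [uIcc_of_ge (by linarith [hc.1])] at hx
      have h1 : -c < x := lt_of_le_of_ne hx.1 (Ne.symm hxc)
      simpa using hlt (-x) ⟨by linarith [hx.2], by linarith⟩

/-- Take the first point `q'` at level `r` on the way from `p`, then the last point `p'` at level
`l` before it. Intervals are unordered because subdividing an arc may reverse its orientation. -/
theorem exists_crossing_uIcc {g : ℝ → ℝ} (hg : Continuous g) {p q l r : ℝ} (hlr : l < r)
    (hp : g p ≤ l) (hq : r ≤ g q) :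
    ∃ p' ∈ uIcc p q, ∃ q' ∈ uIcc p q, g p' = l ∧ g q' = r ∧
      ∀ x ∈ uIcc p' q', x ≠ p' → x ≠ q' → l < g x ∧ g x < r := by
  obtain ⟨q', hq', hgq, hlt⟩ := exists_first_hit_uIcc hg (hp.trans_lt hlr) hq
  obtain ⟨p', hp', hgp, hgt⟩ := exists_first_hit_uIcc (g := fun x => -g x) hg.neg (p := q')
    (q := p) (r := -l) (by linarith) (by linarith)
  rw [uIcc_comm] at hp'
  refine ⟨p', uIcc_subset_uIcc left_mem_uIcc hq' hp', q', hq', by linarith, hgq,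
    fun x hx h1 h2 => ⟨?_, ?_⟩⟩
  · have := hgt x (by rwa [uIcc_comm]) h1
    linarith
  · exact hlt x (uIcc_subset_uIcc hp' right_mem_uIcc hx) h2

end Hitting

/-! ### Downward escape by symmetry -/

section Reflection

variable {μ r : ℝ} {N : ℝ → ℝ} {x y : ℝ → ℝ}

theorem IsTraj.escape_down_of_le (hμ : 0 < μ) (hN : ∀ u, u ≤ r → N u < -1)
    (h : IsTraj μ N univ x y) {t₀ : ℝ} (hx : r ≤ x t₀) (hy : x t₀ = r → y t₀ ≤ 0) {t : ℝ}
    (h0t : t₀ ≤ t) (ht : x t ≤ r) {s : ℝ} (hts : t < s) : x s < r := by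
  have := h.shift_neg_reflect.escape_of_le (r := -r) hμ
    (fun u hu => by linarith [hN (-u) (by linarith)]) (t₀ := t₀ - Real.pi) (t := t - Real.pi)
    (s := s - Real.pi) (by simpa using hx) (by simpa using hy) (by linarith) (by simpa using ht)
    (by linarith)
  simpa using this

end Reflection

/-- The standing assumptions: the nonlinearity `N` has escape levels `±b`; the nonlinearity `M`
agrees with `N` below `-c` and has an escape level there; `V` is the even trajectory starting at
`a < -c` that increases to the level `b` on `[0, T]`. -/
structure Setting (μ a b c T : ℝ) (N M V V' : ℝ → ℝ) : Prop where
  mu_pos : 0 < μ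
  neg_b_lt : -b < a
  lt_neg_c : a < -c
  c_pos : 0 < c
  T_pos : 0 < T
  T_lt : T < Real.pi / 2
  lipschitz : ∃ K, LipschitzWith K N
  odd : ∀ u, N (-u) = -N u
  one_lt : ∀ u, b ≤ u → 1 < N u
  lipschitz' : ∃ K, LipschitzWith K M
  bounded' : ∃ B, ∀ u, |M u| ≤ B
  one_lt' : ∀ u, -c ≤ u → 1 < M u
  agree : ∀ u, u ≤ -c → N u = M u
  traj : IsTraj μ N univ V V'
  init : V 0 = a
  init' : V' 0 = 0
  mono : StrictMonoOn V (Icc 0 T)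
  final : V T = b

/-! ### Intersections of a non-escaping trajectory with one spike -/

namespace Setting

variable {μ a b c T : ℝ} {N M V V' : ℝ → ℝ} (S : Setting μ a b c T N M V V')

include S

theorem T_lt_pi : T < Real.pi := by linarith [S.T_lt, Real.pi_pos]

theorem lt_neg_one (u : ℝ) (hu : u ≤ -b) : N u < -1 := by
  have h1 := S.one_lt (-u) (by linarith)
  rw [S.odd] at h1
  linarith

theorem lt_neg_one' (u : ℝ) (hu : u ≤ -b) : M u < -1 := by
  rw [← S.agree u (by linarith [S.neg_b_lt, S.lt_neg_c])]
  exact S.lt_neg_one u hu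

theorem even (t : ℝ) : V (-t) = V t ∧ V' (-t) = -V' t := by
  obtain ⟨K, hK⟩ := S.lipschitz
  exact S.traj.even hK S.init' t

section Intersections

variable {x y : ℝ → ℝ} (h : IsTraj μ N univ x y)

include h

theorem comparison {t : ℝ} (ht : t ∈ Icc 0 T) (hx : x t = V t) (hy : V' t ≤ y t) : b ≤ x T := by
  obtain ⟨K, hK⟩ := S.lipschitz
  exact IsTraj.comparison S.mu_pos hK S.one_lt S.traj S.T_lt_pi.le S.mono S.final h ht hx hy

/-- At a zero of `x - V` with non-negative slope, comparison would force `x T ≥ b`. So every zero is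
a downward crossing, and there is no way back. -/
theorem sub_neg_of_nonpos (hT : x T < b) {s t : ℝ} (hs : 0 ≤ s) (ht : t ≤ T) (hst : s < t)
    (hx : x s ≤ V s) : x t < V t := by
  have := neg_of_deriv_neg_at_zeros (d := fun τ => x τ - V τ) (d' := fun τ => y τ - V' τ)
    (s := s) (t := t) (fun τ _ => (h τ trivial).1.sub (S.traj τ trivial).1) ?_
    (by linarith) hst
  · linarith
  · intro τ hτ h0
    by_contra hneg
    have := S.comparison h (t := τ) ⟨hs.trans hτ.1, hτ.2.trans ht⟩ (by linarith) (by linarith)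
    linarith

theorem lt_of_init_lt (hT : x T < b) (h0 : x 0 < a) {t : ℝ} (ht : t ∈ Icc 0 T) : x t < V t := by
  rcases ht.1.eq_or_lt with rfl | h1
  · rwa [S.init]
  · exact S.sub_neg_of_nonpos h hT le_rfl ht.2 h1 (by rw [S.init]; exact h0.le)

theorem exists_unique_meet (hT : x T < b) (h0 : a < x 0) :
    ∃ t ∈ Ioo 0 T, ∀ s ∈ Icc 0 T, x s = V s ↔ s = t := by
  have hc : Continuous fun t => V t - x t := S.traj.continuous_fst.sub h.continuous_fst
  obtain ⟨t, ht, ht0, hlt⟩ := exists_first_hit S.T_pos.le hc.continuousOn (r := 0)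
    (by rw [S.init]; linarith) (by rw [S.final]; linarith)
  have htT : t ≠ T := by
    rintro rfl
    rw [S.final] at ht0
    linarith
  refine ⟨t, ⟨ht.1, lt_of_le_of_ne ht.2 htT⟩, fun s hs => ⟨fun hsx => ?_, ?_⟩⟩
  · rcases lt_trichotomy s t with h1 | h1 | h1
    · have := hlt s ⟨hs.1, h1⟩
      linarith
    · exact h1
    · have := S.sub_neg_of_nonpos h hT ht.1.le hs.2 h1 (by linarith)
      linarith
  · rintro rfl
    linarith

theorem lt_spike (hT : x T < b) (hT' : x (-T) < b) (h0 : x 0 < a) {t : ℝ}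
    (ht : t ∈ Icc (-T) T) : x t < V t := by
  rcases le_total 0 t with h1 | h1
  · exact S.lt_of_init_lt h hT h0 ⟨h1, ht.2⟩
  · have := S.lt_of_init_lt (x := fun t => x (-t)) (y := fun t => -y (-t))
      (h.comp_neg.mono (by simp)) hT' (by simpa using h0) (t := -t)
      ⟨by linarith, by linarith [ht.1]⟩
    simpa [(S.even t).1] using this

/-- There is one crossing on each side of `0`. The left side is the right side of the time-reversed
trajectory, since `V` is even; `x` itself need not be even. -/
theorem encard_meet (hT : x T < b) (hT' : x (-T) < b) (h0 : a < x 0) :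
    {t | t ∈ Icc (-T) T ∧ x t = V t}.encard = 2 := by
  obtain ⟨t₁, ht₁, h1⟩ := S.exists_unique_meet h hT h0
  obtain ⟨t₂, ht₂, h2⟩ := S.exists_unique_meet (x := fun t => x (-t)) (y := fun t => -y (-t))
      (h.comp_neg.mono (by simp)) hT' (by simpa using h0)
  have hne : t₁ ≠ -t₂ := by linarith [ht₁.1, ht₂.1]
  rw [← Set.encard_pair hne]
  congr 1
  ext t
  simp only [mem_ofPred_eq, mem_insert_iff, mem_singleton_iff]
  constructor
  · rintro ⟨ht, hx⟩
    rcases le_total 0 t with h3 | h3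
    · exact Or.inl ((h1 t ⟨h3, ht.2⟩).1 hx)
    · have := (h2 (-t) ⟨by linarith, by linarith [ht.1]⟩).1 (by simpa [(S.even t).1] using hx)
      exact Or.inr (by linarith)
  · rintro (rfl | rfl)
    · exact ⟨⟨by linarith [ht₁.1, S.T_pos], ht₁.2.le⟩, (h1 t ⟨ht₁.1.le, ht₁.2.le⟩).2 rfl⟩
    · refine ⟨⟨by linarith [ht₂.2], by linarith [ht₂.1, S.T_pos]⟩, ?_⟩
      rw [(S.even t₂).1]
      exact (h2 t₂ ⟨ht₂.1.le, ht₂.2.le⟩).2 rfl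

end Intersections

end Setting

/-! ### Shooting: arcs of parameters and their subdivision -/

/-- The family of trajectories with `x 0 = α`, `x' 0 = 0`. -/
structure Family (μ : ℝ) (N : ℝ → ℝ) (X Y : ℝ → ℝ → ℝ) : Prop where
  traj : ∀ α, IsTraj μ N univ (X α) (Y α)
  init : ∀ α, X α 0 = α
  init' : ∀ α, Y α 0 = 0

/-- The trajectory seen from time `nπ`, reflected for odd `n`. -/
noncomputable def view (n : ℕ) (x : ℝ → ℝ) (t : ℝ) : ℝ := (-1) ^ n * x (t + n * Real.pi)

theorem view_succ (n : ℕ) (x : ℝ → ℝ) (t : ℝ) : view (n + 1) x t = -view n x (t + Real.pi) := by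
  simp only [view]
  push_cast
  rw [show t + (n + 1) * Real.pi = t + Real.pi + n * Real.pi by ring]
  ring

theorem view_succ_succ (n : ℕ) (x : ℝ → ℝ) (t : ℝ) :
    view (n + 2) x t = view n x (t + 2 * Real.pi) := by
  rw [show n + 2 = (n + 1) + 1 from rfl, view_succ, view_succ, neg_neg]
  ring_nf

theorem IsTraj.view {μ : ℝ} {N x y : ℝ → ℝ} (hN : ∀ u, N (-u) = -N u) (h : IsTraj μ N univ x y)
    (n : ℕ) : IsTraj μ N univ (view n x) (view n y) := by
  induction n with
  | zero =>
    have h1 : ∀ z : ℝ → ℝ, Duffing.view 0 z = z := fun z => by ext t; simp [Duffing.view]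
    rwa [h1, h1]
  | succ n ih =>
    have h1 : ∀ z : ℝ → ℝ, Duffing.view (n + 1) z =
      fun t => -Duffing.view n z (t + Real.pi) := fun z => by ext t; exact view_succ n z t
    rw [h1, h1]
    exact ih.shift_neg hN

/-- At time `nπ` the (reflected) trajectories with parameter between `p` and `q` cover the interval
from the escape level `-b` to the initial level `a` of the spike. -/
structure Arc (a b : ℝ) (X : ℝ → ℝ → ℝ) (n : ℕ) (p q : ℝ) : Prop where
  left_mem : p ∈ Icc (-b) b
  right_mem : q ∈ Icc (-b) b
  left : view n (X p) 0 = -b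
  right : view n (X q) 0 = a
  between : ∀ α ∈ uIcc p q, α ≠ p → α ≠ q → -b < view n (X α) 0 ∧ view n (X α) 0 < a

/-- The trajectory stays between the escape levels at all times `mπ`. -/
def Survives (b : ℝ) (x : ℝ → ℝ) : Prop := ∀ m : ℕ, |view m x 0| ≤ b

namespace Setting

variable {μ a b c T : ℝ} {N M V V' : ℝ → ℝ} (S : Setting μ a b c T N M V V')
  {X Y : ℝ → ℝ → ℝ} (F : Family μ N X Y)

include S F

theorem view_traj (n : ℕ) (α : ℝ) : IsTraj μ N univ (view n (X α)) (view n (Y α)) :=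
  (F.traj α).view S.odd n

omit S in
theorem view_past (n : ℕ) {α : ℝ} (hα : α ∈ Icc (-b) b) :
    |view n (X α) (-(n * Real.pi))| ≤ b ∧ view n (Y α) (-(n * Real.pi)) = 0 := by
  simp [view, F.init, F.init', abs_mul, abs_le, hα.1, hα.2]

/-- The view starts at local time `-nπ`, at rest and within `[-b, b]`; these are the initial data
that the escape lemma asks for. -/
theorem view_escape (n : ℕ) {α : ℝ} (hα : α ∈ Icc (-b) b) {s t : ℝ} (hs : -(n * Real.pi) ≤ s)
    (h : b ≤ view n (X α) s) (hst : s < t) : b < view n (X α) t :=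
  (S.view_traj F n α).escape_of_le S.mu_pos S.one_lt (abs_le.1 (view_past F n hα).1).2
    (fun _ => (view_past F n hα).2.ge) hs h hst

theorem view_escape_down (n : ℕ) {α : ℝ} (hα : α ∈ Icc (-b) b) {s t : ℝ}
    (hs : -(n * Real.pi) ≤ s) (h : view n (X α) s ≤ -b) (hst : s < t) : view n (X α) t < -b :=
  (S.view_traj F n α).escape_down_of_le S.mu_pos S.lt_neg_one
    (abs_le.1 (view_past F n hα).1).1 (fun _ => (view_past F n hα).2.le) hs h hst

omit S F in
theorem neg_mul_pi_nonpos (n : ℕ) : -(n * Real.pi) ≤ 0 := by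
  have : 0 ≤ n * Real.pi := by positivity
  linarith

theorem view_lt_of_left (n : ℕ) {p : ℝ} (hp : p ∈ Icc (-b) b) (h : view n (X p) 0 = -b) {t : ℝ}
    (ht : 0 < t) : view n (X p) t < -b :=
  S.view_escape_down F n hp (neg_mul_pi_nonpos n) h.le ht

theorem view_deriv_of_left (n : ℕ) {p : ℝ} (hp : p ∈ Icc (-b) b) (h : view n (X p) 0 = -b) :
    view n (Y p) 0 ≤ 0 := by
  by_contra hpos
  have h1 := eventually_gt_of_hasDerivAt_pos (S.view_traj F n p 0 trivial).1 (not_le.1 hpos)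
  obtain ⟨t, h2, h3⟩ := (h1.and self_mem_nhdsWithin).exists
  have := S.view_lt_of_left F n hp h h3
  linarith

/-- With negative velocity at height `a`, the time-reversed trajectory would leave the tip of the
spike faster than `V` and reach `b` by time `T`. The trajectory would then have escaped before local
time `0`, where its value is only `a`. -/
theorem view_deriv_of_right (n : ℕ) {q : ℝ} (hq : q ∈ Icc (-b) b) (h : view n (X q) 0 = a) :
    0 ≤ view n (Y q) 0 := by
  rcases Nat.eq_zero_or_pos n with rfl | hn
  · simp [view, F.init']
  by_contra hneg
  have h1 := S.comparison (x := fun t => view n (X q) (-t)) (y := fun t => -view n (Y q) (-t))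
    ((S.view_traj F n q).comp_neg.mono (by simp)) (t := 0) ⟨le_rfl, S.T_pos.le⟩
    (by simpa [S.init] using h) (by simp only [S.init', neg_zero]; linarith)
  have hn' : (1 : ℝ) ≤ n := by exact_mod_cast hn
  have h2 := S.view_escape F n hq (s := -T) (t := 0)
    (by nlinarith [S.T_lt_pi, Real.pi_pos]) h1 (by linarith [S.T_pos])
  linarith [S.lt_neg_c, S.c_pos, S.neg_b_lt]

theorem view_gt_of_right (n : ℕ) {q : ℝ} (hq : q ∈ Icc (-b) b) (h : view n (X q) 0 = a) {t : ℝ}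
    (ht : T < t) : b < view n (X q) t := by
  have h1 := S.comparison (S.view_traj F n q) (t := 0) ⟨le_rfl, S.T_pos.le⟩
    (by rw [h, S.init]) (by rw [S.init']; exact S.view_deriv_of_right F n hq h)
  exact S.view_escape F n hq ((neg_mul_pi_nonpos n).trans S.T_pos.le) h1 ht

theorem continuous_view (n : ℕ) {t : ℝ} (ht : 0 ≤ t) :
    Continuous (fun α => view n (X α) t) ∧ Continuous (fun α => view n (Y α) t) := by
  obtain ⟨K, hK⟩ := S.lipschitz
  have ht' : 0 ≤ t + n * Real.pi := by positivity
  have h1 := continuousOn_traj (s := univ) hK F.traj (by simpa [F.init] using continuous_id')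
    (by simpa [F.init'] using continuous_const) ht'
  rw [← continuousOn_univ, ← continuousOn_univ]
  exact ⟨continuousOn_const.mul h1.1, continuousOn_const.mul h1.2⟩

/-- Both ends of an arc have escaped by the next multiple of `π`: the left end downwards, the right
end upwards by comparison. -/
theorem ne_of_survives {n : ℕ} {p q α : ℝ} (A : Arc a b X n p q) (hα : Survives b (X α)) :
    α ≠ p ∧ α ≠ q := by
  have h1 := abs_le.1 (hα (n + 1))
  rw [view_succ] at h1
  constructor
  · rintro rfl
    have := S.view_lt_of_left F n A.left_mem A.left (t := 0 + Real.pi) (by simp [Real.pi_pos])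
    linarith [h1.2]
  · rintro rfl
    have := S.view_gt_of_right F n A.right_mem A.right (t := 0 + Real.pi) (by simp [S.T_lt_pi])
    linarith [h1.1]

theorem lt_of_survives {n : ℕ} {p q α : ℝ} (A : Arc a b X n p q) (h : α ∈ uIcc p q)
    (hα : Survives b (X α)) : view n (X α) 0 < a :=
  (A.between α h (S.ne_of_survives F A hα).1 (S.ne_of_survives F A hα).2).2

omit S F in
theorem _root_.Duffing.Arc.mem {a b : ℝ} {X : ℝ → ℝ → ℝ} {n : ℕ} {p q α : ℝ}
    (A : Arc a b X n p q) (h : α ∈ uIcc p q) : α ∈ Icc (-b) b :=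
  uIcc_subset_Icc A.left_mem A.right_mem h

omit F in
theorem view_le {n : ℕ} {p q α : ℝ} (A : Arc a b X n p q) (h : α ∈ uIcc p q) :
    view n (X α) 0 ≤ a := by
  by_cases h1 : α = p
  · rw [h1, A.left]; exact S.neg_b_lt.le
  by_cases h2 : α = q
  · rw [h2, A.right]
  exact (A.between α h h1 h2).2.le

/-- Passing from the lower side at time `nπ` to the upper side at time `(n+1)π`. -/
theorem exists_arc_succ {n : ℕ} {p q : ℝ} (A : Arc a b X n p q) :
    ∃ p' ∈ uIcc p q, ∃ q' ∈ uIcc p q, Arc a b X (n + 1) p' q' ∧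
      ∀ α ∈ uIcc p' q', Survives b (X α) →
        view n (X α) 0 < a ∧ view (n + 1) (X α) 0 < a := by
  have hc : Continuous fun α => view (n + 1) (X α) 0 := (S.continuous_view F (n + 1) le_rfl).1
  have hp : a ≤ view (n + 1) (X p) 0 := by
    have := S.view_lt_of_left F n A.left_mem A.left (t := 0 + Real.pi) (by simp [Real.pi_pos])
    rw [view_succ]
    linarith [S.lt_neg_c, S.c_pos, S.neg_b_lt]
  have hq : view (n + 1) (X q) 0 ≤ -b := by
    have := S.view_gt_of_right F n A.right_mem A.right (t := 0 + Real.pi) (by simp [S.T_lt_pi])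
    rw [view_succ]
    linarith
  -- The reflection exchanges the two escape directions, so the new arc is sought from `q` to `p`.
  obtain ⟨p', hp', q', hq', h1, h2, h3⟩ := exists_crossing_uIcc hc S.neg_b_lt hq hp
  rw [uIcc_comm] at hp' hq'
  have A' : Arc a b X (n + 1) p' q' := ⟨A.mem hp', A.mem hq', h1, h2, h3⟩
  exact ⟨p', hp', q', hq', A', fun α hα hs =>
    ⟨S.lt_of_survives F A (uIcc_subset_uIcc hp' hq' hα) hs, S.lt_of_survives F A' hα hs⟩⟩

/-- The trajectories of the modified system with the Cauchy data of the family at time `nπ`. -/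
theorem exists_modified (n : ℕ) : ∃ X' Y' : ℝ → ℝ → ℝ, (∀ α, IsTraj μ M univ (X' α) (Y' α)) ∧
    (∀ α, X' α 0 = view n (X α) 0) ∧ (∀ α, Y' α 0 = view n (Y α) 0) ∧
    ∀ t, 0 ≤ t → Continuous fun α => X' α t := by
  obtain ⟨K, hK⟩ := S.lipschitz'
  obtain ⟨B, hB⟩ := S.bounded'
  choose X' Y' h h0 h0' using fun α => exists_isTraj (μ := μ) hK hB (view n (X α) 0)
    (view n (Y α) 0)
  refine ⟨X', Y', h, h0, h0', fun t ht => ?_⟩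
  have := continuousOn_traj (s := univ) hK h
    (by simpa only [h0] using (S.continuous_view F n le_rfl).1.continuousOn)
    (by simpa only [h0'] using (S.continuous_view F n le_rfl).2.continuousOn) ht
  exact continuousOn_univ.1 this.1

/-- In the modified system, reaching `-c` is irreversible. Being below `-c` at `t₁` therefore means
being below it all along, where both nonlinearities coincide. -/
theorem modified_eq {n : ℕ} {α : ℝ} {x' y' : ℝ → ℝ} (h : IsTraj μ M univ x' y')
    (h0 : x' 0 = view n (X α) 0) (h0' : y' 0 = view n (Y α) 0) (hα : view n (X α) 0 < -c)
    {t₁ : ℝ} (ht : x' t₁ < -c) :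
    ∀ t ∈ Icc 0 t₁, view n (X α) t = x' t ∧ view n (X α) t < -c := by
  obtain ⟨K, hK⟩ := S.lipschitz
  have hlt : ∀ t ∈ Icc 0 t₁, x' t < -c := by
    intro t h1
    by_contra hge
    rcases h1.2.eq_or_lt with rfl | h2
    · exact hge ht
    · have := h.escape_of_le S.mu_pos S.one_lt' (t₀ := 0) (by rw [h0]; exact hα.le)
        (fun h3 => by rw [h0] at h3; linarith) h1.1 (not_lt.1 hge) h2
      linarith
  intro t h1
  have h2 : IsTraj μ N (Icc 0 t₁) x' y' := (h.mono (subset_univ _)).congr_right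
    fun t ht => (S.agree _ (hlt t ht).le).symm
  have := h2.eqOn hK ((S.view_traj F n α).mono (subset_univ _)) h0 h0' t h1
  exact ⟨this.1.symm, this.1 ▸ hlt t h1⟩

/-- Remaining below the level `-c` during a whole period. -/
theorem exists_arc_below {n : ℕ} {p q : ℝ} (A : Arc a b X n p q) :
    ∃ p' ∈ uIcc p q, ∃ q' ∈ uIcc p q, Arc a b X (n + 2) p' q' ∧
      ∀ α ∈ uIcc p' q', Survives b (X α) →
        view n (X α) 0 < a ∧ a < view (n + 1) (X α) 0 ∧ view (n + 2) (X α) 0 < a ∧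
        ∀ t ∈ Icc 0 (2 * Real.pi), view n (X α) t < -c := by
  obtain ⟨X', Y', h, h0, h0', hc⟩ := S.exists_modified F n
  have hπ := Real.pi_pos
  have hac := S.lt_neg_c
  have hp : X' p (2 * Real.pi) ≤ -b := by
    refine ((h p).escape_down_of_le S.mu_pos S.lt_neg_one' (t₀ := 0) (t := 0) ?_ ?_ le_rfl ?_
      (by positivity)).le
    · rw [h0, A.left]
    · intro _
      rw [h0']
      exact S.view_deriv_of_left F n A.left_mem A.left
    · rw [h0, A.left]
  -- Otherwise the true trajectory would still be below `-c` at time `π`, but the right end has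
  -- escaped upwards by then.
  have hq : a ≤ X' q (2 * Real.pi) := by
    by_contra hlt
    have h1 := S.modified_eq F (h q) (h0 q) (h0' q) (by rw [A.right]; exact hac)
      (t₁ := 2 * Real.pi) (by linarith) Real.pi ⟨hπ.le, by linarith⟩
    have h2 := S.view_gt_of_right F n A.right_mem A.right S.T_lt_pi
    linarith [S.neg_b_lt, S.c_pos]
  obtain ⟨p', hp', q', hq', h1, h2, h3⟩ := exists_crossing_uIcc (hc (2 * Real.pi) (by positivity))
    S.neg_b_lt hp hq
  have hsub := uIcc_subset_uIcc hp' hq'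
  have hle : ∀ α ∈ uIcc p' q', X' α (2 * Real.pi) ≤ a := by
    intro α hα
    by_cases e1 : α = p'
    · rw [e1, h1]; exact S.neg_b_lt.le
    by_cases e2 : α = q'
    · rw [e2, h2]
    exact (h3 α hα e1 e2).2.le
  have heq : ∀ α ∈ uIcc p' q', ∀ t ∈ Icc 0 (2 * Real.pi),
      view n (X α) t = X' α t ∧ view n (X α) t < -c := fun α hα =>
    S.modified_eq F (h α) (h0 α) (h0' α) ((S.view_le A (hsub hα)).trans_lt hac)
      ((hle α hα).trans_lt hac)
  have heq' : ∀ α ∈ uIcc p' q', view (n + 2) (X α) 0 = X' α (2 * Real.pi) := by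
    intro α hα
    rw [view_succ_succ, zero_add]
    exact (heq α hα _ ⟨by positivity, le_rfl⟩).1
  have A' : Arc a b X (n + 2) p' q' := by
    refine ⟨A.mem hp', A.mem hq', ?_, ?_, fun α hα e1 e2 => ?_⟩
    · rw [heq' p' left_mem_uIcc, h1]
    · rw [heq' q' right_mem_uIcc, h2]
    · rw [heq' α hα]; exact h3 α hα e1 e2
  refine ⟨p', hp', q', hq', A', fun α hα hs => ⟨S.lt_of_survives F A (hsub hα) hs, ?_,
    S.lt_of_survives F A' hα hs, fun t ht => (heq α hα t ht).2⟩⟩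
  have := (heq α hα Real.pi ⟨hπ.le, by linarith⟩).2
  rw [view_succ, zero_add]
  linarith [S.c_pos]

/-- Rising above the level `-c` at some time of a period without entering the spike. -/
theorem exists_arc_above {n : ℕ} {p q : ℝ} (A : Arc a b X n p q) :
    ∃ p' ∈ uIcc p q, ∃ q' ∈ uIcc p q, Arc a b X (n + 2) p' q' ∧
      ∀ α ∈ uIcc p' q', Survives b (X α) →
        view n (X α) 0 < a ∧ a < view (n + 1) (X α) 0 ∧ view (n + 2) (X α) 0 < a ∧
        ∃ t ∈ Ioo 0 (2 * Real.pi), -c < view n (X α) t := by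
  obtain ⟨X', Y', h, h0, h0', hc⟩ := S.exists_modified F n
  have hπ := Real.pi_pos
  have hac := S.lt_neg_c
  have hc0 := S.c_pos
  have hp : X' p (2 * Real.pi) ≤ -b := by
    refine ((h p).escape_down_of_le S.mu_pos S.lt_neg_one' (t₀ := 0) (t := 0) ?_ ?_ le_rfl ?_
      (by positivity)).le
    · rw [h0, A.left]
    · intro _
      rw [h0']
      exact S.view_deriv_of_left F n A.left_mem A.left
    · rw [h0, A.left]
  -- At time `π` the trajectory of `r` sits at the tip of the next, reflected spike, hence escapes
  -- downwards by `2π`. Parameters nearer to `p` are below `-a` at time `π`, which is the inequality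
  -- wanted at the middle time.
  obtain ⟨r, hr, hra, hlt⟩ := exists_first_hit_uIcc (S.continuous_view F n hπ.le).1
    (p := p) (q := q) (r := -a)
    (by linarith [S.view_lt_of_left F n A.left_mem A.left hπ, S.neg_b_lt])
    (by linarith [S.view_gt_of_right F n A.right_mem A.right S.T_lt_pi, S.neg_b_lt])
  have hr' : -c ≤ X' r (2 * Real.pi) := by
    by_contra hlt'
    have := S.modified_eq F (h r) (h0 r) (h0' r) ((S.view_le A hr).trans_lt hac)
      (t₁ := 2 * Real.pi) (by linarith) Real.pi ⟨hπ.le, by linarith⟩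
    linarith [this.2]
  have hr2 : view (n + 2) (X r) 0 ≤ -b := by
    have h1 : view (n + 1) (X r) 0 = a := by rw [view_succ, zero_add, hra, neg_neg]
    have h2 := S.view_gt_of_right F (n + 1) (A.mem hr) h1 S.T_lt_pi
    rw [view_succ, zero_add]
    linarith
  -- `σ` is the parameter nearest to `r`, towards `p`, whose modified trajectory ends at `a`. Its
  -- true trajectory is the same one and also ends at `a`, so a new arc lies between `r` and `σ`;
  -- strictly between them the modified trajectory ends above `a`.
  obtain ⟨σ, hσ, hσa, hgt⟩ := exists_first_hit_uIcc (g := fun α => -X' α (2 * Real.pi))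
    (hc _ (by positivity)).neg (p := r) (q := p) (r := -a) (by linarith)
    (by linarith [S.neg_b_lt])
  rw [uIcc_comm] at hσ
  have hσpq : σ ∈ uIcc p q := uIcc_subset_uIcc left_mem_uIcc hr hσ
  have hσ2 : a ≤ view (n + 2) (X σ) 0 := by
    rw [view_succ_succ, zero_add]
    have := S.modified_eq F (h σ) (h0 σ) (h0' σ) ((S.view_le A hσpq).trans_lt hac)
      (t₁ := 2 * Real.pi) (by linarith) (2 * Real.pi) ⟨by positivity, le_rfl⟩
    linarith [this.1]
  obtain ⟨p', hp', q', hq', h1, h2, h3⟩ := exists_crossing_uIcc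
    (S.continuous_view F (n + 2) le_rfl).1 S.neg_b_lt hr2 hσ2
  have hsub₁ : uIcc p' q' ⊆ uIcc r σ := uIcc_subset_uIcc hp' hq'
  have hsub₂ : uIcc r σ ⊆ uIcc p r := uIcc_subset_uIcc right_mem_uIcc hσ
  have hsub₃ : uIcc p r ⊆ uIcc p q := uIcc_subset_uIcc left_mem_uIcc hr
  have A' : Arc a b X (n + 2) p' q' :=
    ⟨A.mem (hsub₃ (hsub₂ hp')), A.mem (hsub₃ (hsub₂ hq')), h1, h2, h3⟩
  refine ⟨p', hsub₃ (hsub₂ hp'), q', hsub₃ (hsub₂ hq'), A', fun α hα hs => ?_⟩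
  have hα2 := h3 α hα (S.ne_of_survives F A' hs).1 (S.ne_of_survives F A' hs).2
  have hαr : α ≠ r := by rintro rfl; linarith
  have hασ : α ≠ σ := by rintro rfl; linarith
  have hα' := hsub₁ hα
  have hn := S.lt_of_survives F A (hsub₃ (hsub₂ hα')) hs
  refine ⟨hn, ?_, hα2.2, ?_⟩
  · have := hlt α (hsub₂ hα') hαr
    rw [view_succ, zero_add]
    linarith
  -- A trajectory never exceeding `-c` would coincide with the modified one, which ends above `a`,
  -- while the true one ends below `a`.
  · by_contra hno
    push Not at hno
    obtain ⟨K, hK⟩ := S.lipschitz'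
    have hle : ∀ t ∈ Icc 0 (2 * Real.pi), view n (X α) t ≤ -c := by
      intro t ht
      rcases ht.1.eq_or_lt with rfl | e1
      · linarith
      rcases ht.2.eq_or_lt with rfl | e2
      · have := hα2.2
        rw [view_succ_succ, zero_add] at this
        linarith
      · exact hno t ⟨e1, e2⟩
    have h4 : IsTraj μ M (Icc 0 (2 * Real.pi)) (view n (X α)) (view n (Y α)) :=
      ((S.view_traj F n α).mono (subset_univ _)).congr_right fun t ht => S.agree _ (hle t ht)
    have h5 := (h4.eqOn hK ((h α).mono (subset_univ _)) (h0 α).symm (h0' α).symm (2 * Real.pi)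
      ⟨by positivity, le_rfl⟩).1
    have h6 := hgt α hα' hασ
    have h7 := hα2.2
    rw [view_succ_succ, zero_add] at h7
    linarith

end Setting

/-! ### Truncated cubics and the constants `lam0`, `alpha0` -/

section Cubic

/-- The cubic `x³ - lam x` evaluated at the point of `[l, r]` closest to `u`. -/
noncomputable def truncCubic (lam l r u : ℝ) : ℝ := clamp l r u ^ 3 - lam * clamp l r u

theorem truncCubic_of_mem {lam l r u : ℝ} (h : u ∈ Icc l r) :
    truncCubic lam l r u = u ^ 3 - lam * u := by
  rw [truncCubic, clamp_of_mem h]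

theorem abs_clamp_le {l r R : ℝ} (hlr : l ≤ r) (hl : -R ≤ l) (hr : r ≤ R) (u : ℝ) :
    |clamp l r u| ≤ R :=
  abs_le.2 ⟨hl.trans (clamp_mem hlr u).1, (clamp_mem hlr u).2.trans hr⟩

theorem abs_truncCubic_le (lam : ℝ) {l r R : ℝ} (hlr : l ≤ r) (hl : -R ≤ l) (hr : r ≤ R) (u : ℝ) :
    |truncCubic lam l r u| ≤ R ^ 3 + |lam| * R := by
  have h := abs_clamp_le hlr hl hr u
  refine (abs_sub _ _).trans ?_
  rw [abs_pow, abs_mul]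
  gcongr

theorem lipschitz_truncCubic (lam : ℝ) {l r R : ℝ} (hlr : l ≤ r) (hl : -R ≤ l) (hr : r ≤ R) :
    ∃ K, LipschitzWith K (truncCubic lam l r) := by
  refine ⟨(3 * R ^ 2 + |lam|).toNNReal, LipschitzWith.of_dist_le_mul fun u w => ?_⟩
  rw [Real.coe_toNNReal _ (by positivity)]
  have hu := abs_clamp_le hlr hl hr u
  have hw := abs_clamp_le hlr hl hr w
  have hd : |clamp l r u - clamp l r w| ≤ dist u w := by
    simpa [Real.dist_eq] using (lipschitz_clamp l r).dist_le_mul u w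
  have hR : 0 ≤ R := (abs_nonneg _).trans hu
  rw [Real.dist_eq]
  set x := clamp l r u
  set y := clamp l r w
  have e : truncCubic lam l r u - truncCubic lam l r w =
      (x ^ 2 + x * y + y ^ 2 - lam) * (x - y) := by
    simp only [truncCubic, x, y]; ring
  rw [e, abs_mul]
  refine mul_le_mul ?_ hd (abs_nonneg _) (by positivity)
  have h1 : |x ^ 2| ≤ R ^ 2 := by rw [abs_pow]; gcongr
  have h2 : |y ^ 2| ≤ R ^ 2 := by rw [abs_pow]; gcongr
  have h3 : |x * y| ≤ R ^ 2 := by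
    rw [abs_mul, sq]; gcongr
  calc |x ^ 2 + x * y + y ^ 2 - lam| ≤ |x ^ 2| + |x * y| + |y ^ 2| + |lam| :=
        (abs_sub _ _).trans (by gcongr; exact abs_add_three _ _ _)
    _ ≤ 3 * R ^ 2 + |lam| := by linarith

/-- `2c³`, with `c = √(lam/3)`, is the local maximum value of `x³ - lam x`, attained at `-c`. It
exceeds 1 exactly when `lam³ > 27/4 = lam0³`. -/
theorem sqrt_third_facts {lam : ℝ} (hlam : lam0 < lam) :
    0 < √(lam / 3) ∧ lam = 3 * √(lam / 3) ^ 2 ∧ 1 < 2 * √(lam / 3) ^ 3 := by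
  have h0 : 0 < lam0 := by unfold lam0; positivity
  have hl : 0 < lam := h0.trans hlam
  have hc : 0 < √(lam / 3) := Real.sqrt_pos.2 (by positivity)
  have hsq : √(lam / 3) ^ 2 = lam / 3 := Real.sq_sqrt (by positivity)
  refine ⟨hc, by linarith, ?_⟩
  have hcube : lam0 ^ 3 = 27 / 4 := by
    have : ((2 : ℝ) ^ ((2 : ℝ) / 3)) ^ 3 = 4 := by
      rw [← Real.rpow_natCast, ← Real.rpow_mul (by norm_num)]
      norm_num
    rw [lam0, div_pow, this]
    norm_num
  have h3 : lam0 ^ 3 < lam ^ 3 := pow_lt_pow_left₀ hlam h0.le (by norm_num)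
  have h6 : (√(lam / 3) ^ 3) ^ 2 = lam ^ 3 / 27 := by
    calc (√(lam / 3) ^ 3) ^ 2 = (√(lam / 3) ^ 2) ^ 3 := by ring
      _ = lam ^ 3 / 27 := by rw [hsq]; ring
  have h7 : 0 < √(lam / 3) ^ 3 := by positivity
  nlinarith

theorem lt_sq_of_level {lam b : ℝ} (hb : 0 < b) (hb' : 0 < b ^ 3 - lam * b - 1) : lam < b ^ 2 := by
  by_contra h
  nlinarith

/-- Left of `-b` the expression `x³ - lam x + 1` is negative, so it has no root there. -/
theorem neg_le_alpha0 {lam b : ℝ} (hb : 0 < b) (hb' : 0 < b ^ 3 - lam * b - 1) :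
    -b ≤ alpha0 lam := by
  have hlb := lt_sq_of_level hb hb'
  have key : ∀ x ∈ {x : ℝ | x ^ 3 - lam * x + 1 = 0}, -b ≤ x := by
    intro x (hx : x ^ 3 - lam * x + 1 = 0)
    by_contra hlt
    have h1 : 0 < -x - b := by linarith
    have h2 : 0 < x ^ 2 - x * b + b ^ 2 - lam := by nlinarith
    nlinarith [mul_pos h1 h2]
  unfold alpha0
  -- The default `sInf ∅ = 0` also satisfies the bound, so no root has to be produced.
  rcases eq_empty_or_nonempty {x : ℝ | x ^ 3 - lam * x + 1 = 0} with h | h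
  · rw [h, Real.sInf_empty]; linarith
  · exact le_csInf h key

end Cubic

/-! ### From the hypotheses on `v` to the abstract setting -/

section Setup

variable {ε lam b a T : ℝ} {v : ℝ → ℝ}

theorem IsSolutionOn.isTraj (hε : 0 < ε) {s : Set ℝ} (h : IsSolutionOn ε lam v s) :
    IsTraj (1 / ε ^ 2) (fun u => u ^ 3 - lam * u) s v (deriv v) := by
  intro t ht
  obtain ⟨h1, h2, h3⟩ := h t ht
  refine ⟨h1.hasDerivAt, h2.hasDerivAt.congr_deriv ?_⟩
  rw [← h3]
  field_simp

theorem IsTraj.isSolutionOn (hε : 0 < ε) {x y : ℝ → ℝ}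
    (h : IsTraj (1 / ε ^ 2) (fun u => u ^ 3 - lam * u) univ x y) :
    IsSolutionOn ε lam x univ ∧ deriv x = y := by
  have hd : deriv x = y := funext fun t => (h t trivial).1.deriv
  refine ⟨fun t ht => ⟨(h t ht).1.differentiableAt, ?_, ?_⟩, hd⟩
  · rw [hd]; exact (h t ht).2.differentiableAt
  · rw [hd, (h t ht).2.deriv]
    field_simp

theorem ConditionA.exists_setting (hε : 0 < ε) (hlam : lam0 < lam) (hb : 0 < b)
    (hb' : 0 < b ^ 3 - lam * b - 1) (hA : ConditionA ε lam b a v T) :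
    ∃ V V' : ℝ → ℝ, Setting (1 / ε ^ 2) a b √(lam / 3) T (truncCubic lam (-b) b)
      (truncCubic lam (-b) (-√(lam / 3))) V V' ∧ ∀ t ∈ Icc (-T) T, v t = V t := by
  obtain ⟨hc0, hlc, hc3⟩ := sqrt_third_facts hlam
  have hba : -b < a := (neg_le_alpha0 hb hb').trans_lt hA.alpha0_lt
  have hac := hA.lt_neg_sqrt
  have hTpos := hA.T_pos
  set c := √(lam / 3)
  obtain ⟨K, hK⟩ := lipschitz_truncCubic lam (l := -b) (r := b) (R := b) (by linarith) le_rfl le_rfl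
  obtain ⟨V, V', hV, hV0, hV0'⟩ := exists_isTraj (μ := 1 / ε ^ 2) hK
    (abs_truncCubic_le lam (l := -b) (r := b) (R := b) (by linarith) le_rfl le_rfl) a 0
  obtain ⟨R, hR, hsol⟩ := hA.isSolution
  have hv := hsol.isTraj hε
  have hvmem : ∀ t ∈ Icc 0 T, v t ∈ Icc (-b) b := by
    intro t ht
    have h0 : (0 : ℝ) ∈ Icc 0 T := ⟨le_rfl, hTpos.le⟩
    have hTT : T ∈ Icc 0 T := ⟨hTpos.le, le_rfl⟩
    constructor
    · have := hA.strictMono.monotoneOn h0 ht ht.1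
      rw [hA.init] at this
      linarith
    · have := hA.strictMono.monotoneOn ht hTT ht.2
      rwa [hA.crosses] at this
  have hvV : ∀ t ∈ Icc 0 T, v t = V t := by
    have h1 : IsTraj (1 / ε ^ 2) (truncCubic lam (-b) b) (Icc 0 T) v (deriv v) :=
      (hv.mono fun t ht => ⟨by linarith [ht.1], by linarith [ht.2]⟩).congr_right
        fun t ht => (truncCubic_of_mem (hvmem t ht)).symm
    exact fun t ht => (h1.eqOn hK (hV.mono (subset_univ _)) (by rw [hA.init, hV0])
      (by rw [hA.deriv_init, hV0']) t ht).1
  have S : Setting (1 / ε ^ 2) a b c T (truncCubic lam (-b) b) (truncCubic lam (-b) (-c)) V V' := by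
    refine ⟨by positivity, hba, hac, hc0, hTpos, hA.T_lt, ⟨K, hK⟩, fun u => ?_, fun u hu => ?_,
      lipschitz_truncCubic lam (R := b) (by linarith) le_rfl (by linarith), ⟨_, abs_truncCubic_le
        lam (R := b) (by linarith) le_rfl (by linarith)⟩, fun u hu => ?_, fun u hu => ?_, hV, hV0,
      hV0', ?_, ?_⟩
    · have : clamp (-b) b (-u) = -clamp (-b) b u := by
        simp only [clamp]
        rcases le_total u b with h1 | h1 <;> rcases le_total (-b) u with h2 | h2 <;>
          simp [min_def, max_def] <;> split_ifs <;> linarith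
      simp only [truncCubic, this]
      ring
    · rw [truncCubic, clamp_of_ge (by linarith) hu]
      linarith
    · rw [truncCubic, clamp_of_ge (by linarith) hu, hlc]
      nlinarith
    · have h1 : min u b = u := min_eq_left (by linarith)
      have h2 : min u (-c) = u := min_eq_left hu
      simp only [truncCubic, clamp, h1, h2]
    · exact hA.strictMono.congr fun t ht => hvV t ht
    · rw [← hvV T ⟨hTpos.le, le_rfl⟩, hA.crosses]
  refine ⟨V, V', S, fun t ht => ?_⟩
  rcases le_total 0 t with h0 | h0
  · exact hvV t ⟨h0, ht.2⟩
  have hvn : IsTraj (1 / ε ^ 2) (fun u => u ^ 3 - lam * u) (Icc 0 T) (fun t => v (-t))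
      (fun t => -deriv v (-t)) :=
    hv.comp_neg.mono fun t ht => by
      simp only [Set.mem_neg, mem_Ioo]
      exact ⟨by linarith [ht.2], by linarith [ht.1]⟩
  -- No bound for `v` by `b` is yet known to the left of `0`. Truncating at a level `Q` that bounds
  -- both `v (-t)` and `V` gives uniqueness, hence the evenness of `v` on `[-T, T]`.
  obtain ⟨B, hB⟩ := isCompact_Icc.exists_bound_of_continuousOn (s := Icc 0 T)
    (f := fun t => v (-t)) fun t ht => (hvn t ht).1.continuousAt.continuousWithinAt
  set Q := max B b
  have hQb : b ≤ Q := le_max_right _ _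
  obtain ⟨K', hK'⟩ := lipschitz_truncCubic lam (l := -Q) (r := Q) (R := Q) (by linarith) le_rfl
    le_rfl
  have h1 : IsTraj (1 / ε ^ 2) (truncCubic lam (-Q) Q) (Icc 0 T) (fun t => v (-t))
      (fun t => -deriv v (-t)) := hvn.congr_right fun t ht =>
    (truncCubic_of_mem (abs_le.1 ((hB t ht).trans (le_max_left _ _)))).symm
  have h2 : IsTraj (1 / ε ^ 2) (truncCubic lam (-Q) Q) (Icc 0 T) V V' := by
    refine (hV.mono (subset_univ _)).congr_right fun t ht => ?_
    have hm := hvmem t ht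
    rw [hvV t ht] at hm
    rw [truncCubic_of_mem hm, truncCubic_of_mem ⟨by linarith [hm.1], by linarith [hm.2]⟩]
  have := (h1.eqOn hK' h2 (by simp [hA.init, hV0]) (by simp [hA.deriv_init, hV0']) (-t)
    ⟨by linarith, by linarith [ht.1]⟩).1
  simpa [(S.even t).1] using this

end Setup

/-! ### Realizing a symbol sequence by nested arcs -/

section Coding

/-- The period index at which the arc chosen after `j` symbols ends. -/
def stage (ω : ℕ → ℕ) : ℕ → ℕ
  | 0 => 0
  | j + 1 => if ω (j + 1) = 4 ∨ ω (j + 1) = 5 then 2 * j + 3 else 2 * j + 2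

/-- The requirement that the symbol `w` puts on a trajectory at times `2jπ, …, (2j+3)π`. -/
def Codes (a c : ℝ) (w j : ℕ) (x : ℝ → ℝ) : Prop :=
  ((w = 1 ∨ w = 2) → view (2 * j) x 0 < a ∧ a < view (2 * j + 1) x 0 ∧
    view (2 * j + 2) x 0 < a) ∧
  (w = 1 → ∀ t ∈ Icc 0 (2 * Real.pi), view (2 * j) x t < -c) ∧
  (w = 2 → ∃ t ∈ Ioo 0 (2 * Real.pi), -c < view (2 * j) x t) ∧
  (w = 3 → view (2 * j + 1) x 0 < a ∧ view (2 * j + 2) x 0 < a) ∧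
  ((w = 4 ∨ w = 5) → view (2 * j + 1) x 0 < a ∧ a < view (2 * j + 2) x 0 ∧
    view (2 * j + 3) x 0 < a) ∧
  (w = 4 → ∃ t ∈ Ioo 0 (2 * Real.pi), -c < view (2 * j + 1) x t) ∧
  (w = 5 → ∀ t ∈ Icc 0 (2 * Real.pi), view (2 * j + 1) x t < -c)

variable {μ a b c T : ℝ} {N M V V' : ℝ → ℝ} {X Y : ℝ → ℝ → ℝ} {ω : ℕ → ℕ}

theorem Setting.exists_arc_of_odd (S : Setting μ a b c T N M V V') (F : Family μ N X Y) {j : ℕ}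
    (hω : ω (j + 1) = 3 ∨ ω (j + 1) = 4 ∨ ω (j + 1) = 5) {p q : ℝ}
    (A : Arc a b X (2 * j + 1) p q) :
    ∃ p' ∈ uIcc p q, ∃ q' ∈ uIcc p q, Arc a b X (stage ω (j + 1)) p' q' ∧
      ∀ α ∈ uIcc p' q', Survives b (X α) → Codes a c (ω (j + 1)) j (X α) := by
  rcases hω with h | h | h
  · obtain ⟨p', hp', q', hq', A', hP⟩ := S.exists_arc_succ F A
    refine ⟨p', hp', q', hq', by simpa [stage, h] using A', fun α hα hs => ?_⟩
    simpa [Codes, h] using hP α hα hs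
  · obtain ⟨p', hp', q', hq', A', hP⟩ := S.exists_arc_above F A
    refine ⟨p', hp', q', hq', by simpa [stage, h] using A', fun α hα hs => ?_⟩
    obtain ⟨h1, h2, h3, h4⟩ := hP α hα hs
    simpa [Codes, h] using ⟨⟨h1, h2, h3⟩, h4⟩
  · obtain ⟨p', hp', q', hq', A', hP⟩ := S.exists_arc_below F A
    refine ⟨p', hp', q', hq', by simpa [stage, h] using A', fun α hα hs => ?_⟩
    obtain ⟨h1, h2, h3, h4⟩ := hP α hα hs
    simpa [Codes, h] using ⟨⟨h1, h2, h3⟩, fun t h5 h6 => h4 t ⟨h5, h6⟩⟩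

/-- After a 4 or 5 the arc already ends at the odd time `(2j+1)π`, with the value below `a`. The
next symbol is then 3, 4 or 5, and each of these requires exactly that. From an even time, a 1 or 2
takes one double step, while 3, 4 and 5 first pass through an arc at the odd time. -/
theorem Setting.exists_arc_step (S : Setting μ a b c T N M V V') (F : Family μ N X Y)
    (hω : ∀ k, 1 ≤ k → ω k ∈ Icc 1 5)
    (h45 : ∀ k, 1 ≤ k → (ω k = 4 ∨ ω k = 5) → ¬ (ω (k + 1) = 1 ∨ ω (k + 1) = 2)) (j : ℕ)
    {p q : ℝ} (A : Arc a b X (stage ω j) p q) :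
    ∃ p' ∈ uIcc p q, ∃ q' ∈ uIcc p q, Arc a b X (stage ω (j + 1)) p' q' ∧
      ∀ α ∈ uIcc p' q', Survives b (X α) → Codes a c (ω (j + 1)) j (X α) := by
  obtain ⟨hw1, hw5⟩ := hω (j + 1) (by omega)
  have hst : stage ω j = 2 * j ∨ (stage ω j = 2 * j + 1 ∧
      (ω (j + 1) = 3 ∨ ω (j + 1) = 4 ∨ ω (j + 1) = 5)) := by
    cases j with
    | zero => exact Or.inl rfl
    | succ i =>
      by_cases h : ω (i + 1) = 4 ∨ ω (i + 1) = 5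
      · right
        refine ⟨by simp only [stage, if_pos h]; omega, ?_⟩
        have := h45 (i + 1) (by omega) h
        omega
      · left
        simp only [stage, if_neg h]; omega
  rcases hst with hs | ⟨hs, hw⟩
  · rw [hs] at A
    have hcase : ω (j + 1) = 1 ∨ ω (j + 1) = 2 ∨
      (ω (j + 1) = 3 ∨ ω (j + 1) = 4 ∨ ω (j + 1) = 5) := by omega
    rcases hcase with h | h | h
    · obtain ⟨p', hp', q', hq', A', hP⟩ := S.exists_arc_below F A
      refine ⟨p', hp', q', hq', by simpa [stage, h] using A', fun α hα hs => ?_⟩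
      obtain ⟨h1, h2, h3, h4⟩ := hP α hα hs
      simpa [Codes, h] using ⟨⟨h1, h2, h3⟩, fun t h5 h6 => h4 t ⟨h5, h6⟩⟩
    · obtain ⟨p', hp', q', hq', A', hP⟩ := S.exists_arc_above F A
      refine ⟨p', hp', q', hq', by simpa [stage, h] using A', fun α hα hs => ?_⟩
      obtain ⟨h1, h2, h3, h4⟩ := hP α hα hs
      simpa [Codes, h] using ⟨⟨h1, h2, h3⟩, h4⟩
    · obtain ⟨p₁, hp₁, q₁, hq₁, A₁, -⟩ := S.exists_arc_succ F A
      obtain ⟨p', hp', q', hq', A', hP⟩ := S.exists_arc_of_odd F h A₁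
      have hsub := uIcc_subset_uIcc hp₁ hq₁
      exact ⟨p', hsub hp', q', hsub hq', A', hP⟩
  · rw [hs] at A
    exact S.exists_arc_of_odd F hw A

theorem le_stage (ω : ℕ → ℕ) (j : ℕ) : 2 * j ≤ stage ω j := by
  cases j with
  | zero => simp [stage]
  | succ j => simp only [stage]; split_ifs <;> omega

/-- A trajectory that lies strictly between the escape levels and realizes the code `ω`. -/
theorem Setting.exists_coded (S : Setting μ a b c T N M V V') (F : Family μ N X Y)
    (hω : ∀ k, 1 ≤ k → ω k ∈ Icc 1 5)
    (h45 : ∀ k, 1 ≤ k → (ω k = 4 ∨ ω k = 5) → ¬ (ω (k + 1) = 1 ∨ ω (k + 1) = 2)) :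
    ∃ α ∈ Icc (-b) b, Survives b (X α) ∧ ∀ j, Codes a c (ω (j + 1)) j (X α) := by
  have hb : 0 < b := by linarith [S.neg_b_lt, S.lt_neg_c, S.c_pos]
  have hab : a < b := by linarith [S.lt_neg_c, S.c_pos]
  have A₀ : Arc a b X (stage ω 0) (-b) a := by
    refine ⟨⟨le_rfl, by linarith⟩, ⟨S.neg_b_lt.le, hab.le⟩, by simp [stage, view, F.init],
      by simp [stage, view, F.init], fun α hα h1 h2 => ?_⟩
    rw [uIcc_of_le S.neg_b_lt.le] at hα
    simp only [stage, view, pow_zero, Nat.cast_zero, zero_mul, add_zero, one_mul, F.init]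
    exact ⟨lt_of_le_of_ne hα.1 (Ne.symm h1), lt_of_le_of_ne hα.2 h2⟩
  have step : ∀ (j : ℕ) (z : ℝ × ℝ), Arc a b X (stage ω j) z.1 z.2 → ∃ z' : ℝ × ℝ,
      uIcc z'.1 z'.2 ⊆ uIcc z.1 z.2 ∧ Arc a b X (stage ω (j + 1)) z'.1 z'.2 ∧
      ∀ α ∈ uIcc z'.1 z'.2, Survives b (X α) → Codes a c (ω (j + 1)) j (X α) := by
    intro j z A
    obtain ⟨p', hp', q', hq', A', hP⟩ := S.exists_arc_step F hω h45 j A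
    exact ⟨(p', q'), uIcc_subset_uIcc hp' hq', A', hP⟩
  choose! f hf using step
  let z : ℕ → ℝ × ℝ := fun j => Nat.rec (-b, a) f j
  have hA : ∀ j, Arc a b X (stage ω j) (z j).1 (z j).2 := by
    intro j
    induction j with
    | zero => exact A₀
    | succ j ih => exact (hf j (z j) ih).2.1
  obtain ⟨α, hα⟩ := IsCompact.nonempty_iInter_of_sequence_nonempty_isCompact_isClosed
    (fun j => uIcc (z j).1 (z j).2) (fun j => (hf j (z j) (hA j)).1) (fun j => nonempty_uIcc)
    isCompact_uIcc (fun j => isClosed_Icc)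
  rw [mem_iInter] at hα
  have hαb : α ∈ Icc (-b) b := (hA 0).mem (hα 0)
  have hsurv : Survives b (X α) := by
    intro m
    by_contra hm
    -- An escape by time `mπ` would persist until the later time of this stage, where membership in
    -- the arc bounds the value by `b`.
    have hlt : m < stage ω (m + 1) := by have := le_stage ω (m + 1); omega
    have hpos : 0 < ((stage ω (m + 1) : ℝ) - m) * Real.pi :=
      mul_pos (sub_pos.2 (by exact_mod_cast hlt)) Real.pi_pos
    have hle : view (stage ω (m + 1)) (X α) 0 ≤ a := S.view_le (hA (m + 1)) (hα (m + 1))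
    have hge : -b ≤ view (stage ω (m + 1)) (X α) 0 := by
      by_cases h1 : α = (z (m + 1)).1
      · rw [h1, (hA (m + 1)).left]
      by_cases h2 : α = (z (m + 1)).2
      · rw [h2, (hA (m + 1)).right]; exact S.neg_b_lt.le
      exact ((hA (m + 1)).between α (hα (m + 1)) h1 h2).1.le
    have habs : |X α (stage ω (m + 1) * Real.pi)| ≤ b := by
      have : |view (stage ω (m + 1)) (X α) 0| ≤ b := abs_le.2 ⟨hge, hle.trans hab.le⟩
      simpa [view, abs_mul] using this
    have hX : ∀ t, view 0 (X α) t = X α t := fun t => by simp [view]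
    have hm' : b < |X α (m * Real.pi)| := by simpa [view, abs_mul] using hm
    have hmpi : -((0 : ℕ) * Real.pi) ≤ m * Real.pi := by
      have : 0 ≤ m * Real.pi := by positivity
      simpa using this
    rcases lt_abs.1 hm' with h1 | h1
    · have := S.view_escape F 0 hαb hmpi (by rw [hX]; exact h1.le)
        (t := stage ω (m + 1) * Real.pi) (by linarith)
      rw [hX] at this
      linarith [(abs_le.1 habs).2]
    · have := S.view_escape_down F 0 hαb hmpi (by rw [hX]; linarith)
        (t := stage ω (m + 1) * Real.pi) (by linarith)
      rw [hX] at this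
      linarith [(abs_le.1 habs).1]
  exact ⟨α, hαb, hsurv, fun j => (hf j (z j) (hA j)).2.2 α (hα (j + 1)) hsurv⟩

/-- Touching `±b` at any time `t ≥ 0` is an escape, visible at every later multiple of `π`. Negative
times follow by evenness. -/
theorem Setting.abs_lt_of_survives (S : Setting μ a b c T N M V V') (F : Family μ N X Y) {α : ℝ}
    (hα : α ∈ Icc (-b) b) (hs : Survives b (X α)) (t : ℝ) : |X α t| < b := by
  have hX : ∀ t, view 0 (X α) t = X α t := fun t => by simp [view]
  have key : ∀ t, 0 ≤ t → |X α t| < b := by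
    intro t ht
    by_contra hge
    obtain ⟨m, hm⟩ := exists_nat_gt (t / Real.pi)
    rw [div_lt_iff₀ Real.pi_pos] at hm
    have h1 : |X α (m * Real.pi)| ≤ b := by simpa [view, abs_mul] using hs m
    rcases le_abs.1 (not_lt.1 hge) with h2 | h2
    · have := S.view_escape F 0 hα (s := t) (by simpa using ht) (by rwa [hX]) hm
      rw [hX] at this
      linarith [(abs_le.1 h1).2]
    · have := S.view_escape_down F 0 hα (s := t) (by simpa using ht) (by rw [hX]; linarith) hm
      rw [hX] at this
      linarith [(abs_le.1 h1).1]
  rcases le_total 0 t with h | h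
  · exact key t h
  · obtain ⟨K, hK⟩ := S.lipschitz
    rw [← ((F.traj α).even hK (F.init' α) t).1]
    exact key (-t) (by linarith)

end Coding

/-! ### Translation to the spikes `w_n` -/

section Spikes

variable {μ a b c T : ℝ} {N M V V' v x y : ℝ → ℝ}

theorem view_sub (n : ℕ) (x : ℝ → ℝ) (t : ℝ) :
    view n x (t - n * Real.pi) = (-1) ^ n * x t := by
  simp [view]

theorem abs_view (n : ℕ) (x : ℝ → ℝ) (t : ℝ) : |view n x t| = |x (t + n * Real.pi)| := by
  simp [view, abs_mul]

theorem meets_eq_image (v : ℝ → ℝ) (T : ℝ) (x : ℝ → ℝ) (n : ℕ) :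
    meets v T x n = (fun t => t + n * Real.pi) '' {t | t ∈ Icc (-T) T ∧ view n x t = v t} := by
  have hsq : ((-1 : ℝ) ^ n) * (-1) ^ n = 1 := by
    rw [← mul_pow]; simp
  ext t
  simp only [meets, spikeDom, spike, mem_ofPred_eq, mem_image, mem_Icc, Int.cast_natCast,
    zpow_natCast]
  constructor
  · rintro ⟨⟨h1, h2⟩, h3⟩
    refine ⟨t - n * Real.pi, ⟨⟨by linarith, by linarith⟩, ?_⟩, by ring⟩
    rw [view_sub, h3, ← mul_assoc, hsq, one_mul]
  · rintro ⟨s, ⟨⟨h1, h2⟩, h3⟩, rfl⟩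
    refine ⟨⟨by linarith, by linarith⟩, ?_⟩
    rw [add_sub_cancel_right, ← h3, view, ← mul_assoc, hsq, one_mul]

theorem Setting.view_lt_spike (S : Setting μ a b c T N M V V') (hv : ∀ t ∈ Icc (-T) T, v t = V t)
    (h : IsTraj μ N univ x y) (hx : ∀ t, |x t| < b) {n : ℕ} (h0 : view n x 0 < a) {t : ℝ}
    (ht : t ∈ Icc (-T) T) : view n x t < v t := by
  have hlt : ∀ t, view n x t < b := fun t => (abs_lt.1 (abs_view n x t ▸ hx _)).2
  rw [hv t ht]
  exact S.lt_spike (h.view S.odd n) (hlt _) (hlt _) h0 ht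

theorem Setting.meets_eq_empty (S : Setting μ a b c T N M V V')
    (hv : ∀ t ∈ Icc (-T) T, v t = V t) (h : IsTraj μ N univ x y) (hx : ∀ t, |x t| < b) {n : ℕ}
    (h0 : view n x 0 < a) : meets v T x n = ∅ := by
  rw [meets_eq_image, image_eq_empty, eq_empty_iff_forall_notMem]
  rintro t ⟨ht, h1⟩
  exact (S.view_lt_spike hv h hx h0 ht).ne h1

theorem Setting.encard_meets (S : Setting μ a b c T N M V V')
    (hv : ∀ t ∈ Icc (-T) T, v t = V t) (h : IsTraj μ N univ x y) (hx : ∀ t, |x t| < b) {n : ℕ}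
    (h0 : a < view n x 0) : (meets v T x n).encard = 2 := by
  have hlt : ∀ t, view n x t < b := fun t => (abs_lt.1 (abs_view n x t ▸ hx _)).2
  rw [meets_eq_image, (add_left_injective _).encard_image,
    ← S.encard_meet (h.view S.odd n) (hlt _) (hlt _) h0]
  congr 1
  ext t
  simp only [mem_ofPred_eq]
  exact and_congr_right fun ht => by rw [hv t ht]

/-- As `T < π/2`, a spike of the parity of `n` that reaches into this period is centred at one of
its two ends. -/
theorem index_of_mem_spikeDom (hT : T < Real.pi / 2) {n : ℕ} {t : ℝ}
    (ht : t ∈ Ioo (n * Real.pi) ((n + 2) * Real.pi)) {k : ℤ} (hk : t ∈ spikeDom T k)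
    (hpar : Even (k - n)) : k = n ∨ k = (n + 2 : ℕ) := by
  obtain ⟨h1, h2⟩ := hk
  have hπ := Real.pi_pos
  have h3 : (n : ℝ) - 1 < k := by
    by_contra hle
    nlinarith [ht.1]
  have h4 : (k : ℝ) < n + 3 := by
    by_contra hle
    nlinarith [ht.2]
  have h5 : (n : ℤ) - 1 < k := by exact_mod_cast h3
  have h6 : k < (n : ℤ) + 3 := by exact_mod_cast h4
  obtain ⟨i, hi⟩ := hpar
  push_cast
  omega

theorem Setting.view_lt_of_spikeDom (S : Setting μ a b c T N M V V')
    (hv : ∀ t ∈ Icc (-T) T, v t = V t) (h : IsTraj μ N univ x y) (hx : ∀ t, |x t| < b) {n : ℕ}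
    (h0 : view n x 0 < a) (h2 : view (n + 2) x 0 < a) {t : ℝ}
    (ht : t ∈ Ioo (n * Real.pi) ((n + 2) * Real.pi)) {k : ℤ} (hk : t ∈ spikeDom T k)
    (hpar : Even (k - n)) : (-1) ^ n * x t < v (t - k * Real.pi) := by
  have hmem : t - k * Real.pi ∈ Icc (-T) T := ⟨by linarith [hk.1], by linarith [hk.2]⟩
  rcases index_of_mem_spikeDom S.T_lt ht hk hpar with rfl | rfl
  · rw [Int.cast_natCast] at hmem ⊢
    rw [← view_sub]
    exact S.view_lt_spike hv h hx h0 hmem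
  · rw [Int.cast_natCast] at hmem ⊢
    have : (-1 : ℝ) ^ n = (-1) ^ (n + 2) := by rw [pow_add]; simp
    rw [this, ← view_sub]
    exact S.view_lt_spike hv h hx h2 hmem

end Spikes

end Duffing

theorem theorem5 (ε lam b a T : ℝ) (v : ℝ → ℝ)
    (hε : 0 < ε) (hlam : Duffing.lam0 < lam)
    (hb : 0 < b) (hb' : 0 < b ^ 3 - lam * b - 1)
    (hA : Duffing.ConditionA ε lam b a v T)
    (ω : ℕ → ℕ) (hω : ∀ k, 1 ≤ k → ω k ∈ Set.Icc 1 5)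
    (h12 : ∀ k, 1 ≤ k → (ω k = 1 ∨ ω k = 2) → ¬ (ω (k + 1) = 4 ∨ ω (k + 1) = 5))
    (h45 : ∀ k, 1 ≤ k → (ω k = 4 ∨ ω k = 5) → ¬ (ω (k + 1) = 1 ∨ ω (k + 1) = 2)) :
    ∃ u : ℝ → ℝ, Duffing.IsSolutionOn ε lam u Set.univ ∧ deriv u 0 = 0 ∧
      ∀ k : ℕ, 1 ≤ k →
        ((ω k = 1 ∨ ω k = 2) →
          (Duffing.meets v T u (2 * (k : ℤ) - 1)).encard = 2 ∧
          Duffing.meets v T u (2 * (k : ℤ)) = ∅) ∧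
        (ω k = 1 →
          ∀ t ∈ Set.Ioo ((2 * (k : ℝ) - 2) * Real.pi) (2 * (k : ℝ) * Real.pi),
            u t < Duffing.gMinus lam v T b t) ∧
        (ω k = 2 →
          ∃ t ∈ Set.Ioo ((2 * (k : ℝ) - 2) * Real.pi) (2 * (k : ℝ) * Real.pi),
            Duffing.gMinus lam v T b t < u t) ∧
        (ω k = 3 →
          Duffing.meets v T u (2 * (k : ℤ) - 1) = ∅ ∧
          Duffing.meets v T u (2 * (k : ℤ)) = ∅) ∧
        ((ω k = 4 ∨ ω k = 5) →
          Duffing.meets v T u (2 * (k : ℤ) - 1) = ∅ ∧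
          (Duffing.meets v T u (2 * (k : ℤ))).encard = 2) ∧
        (ω k = 4 →
          ∃ t ∈ Set.Ioo ((2 * (k : ℝ) - 1) * Real.pi) ((2 * (k : ℝ) + 1) * Real.pi),
            u t < Duffing.gPlus lam v T b t) ∧
        (ω k = 5 →
          ∀ t ∈ Set.Ioo ((2 * (k : ℝ) - 1) * Real.pi) ((2 * (k : ℝ) + 1) * Real.pi),
            Duffing.gPlus lam v T b t < u t) := by
  obtain ⟨V, V', S, hv⟩ := hA.exists_setting hε hlam hb hb'
  obtain ⟨K, hK⟩ := S.lipschitz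
  choose X Y hXY hX0 hY0 using fun α => Duffing.exists_isTraj (μ := 1 / ε ^ 2) hK
    (Duffing.abs_truncCubic_le lam (l := -b) (r := b) (R := b) (by linarith) le_rfl le_rfl) α 0
  have F : Duffing.Family (1 / ε ^ 2) (Duffing.truncCubic lam (-b) b) X Y := ⟨hXY, hX0, hY0⟩
  obtain ⟨α, hα, hs, hcode⟩ := S.exists_coded F hω h45
  have hx := S.abs_lt_of_survives F hα hs
  have htraj := F.traj α
  obtain ⟨hsol, hder⟩ := Duffing.IsTraj.isSolutionOn hε (htraj.congr_right fun t _ =>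
    Duffing.truncCubic_of_mem (abs_le.1 (hx t).le))
  refine ⟨X α, hsol, by rw [hder, F.init'], fun k hk => ?_⟩
  obtain ⟨j, rfl⟩ : ∃ j, k = j + 1 := ⟨k - 1, by omega⟩
  obtain ⟨c12, c1, c2, c3, c45, c4, c5⟩ := hcode j
  have e1 : 2 * ((j + 1 : ℕ) : ℤ) - 1 = ((2 * j + 1 : ℕ) : ℤ) := by push_cast; ring
  have e2 : 2 * ((j + 1 : ℕ) : ℤ) = ((2 * j + 2 : ℕ) : ℤ) := by push_cast; ring
  have r1 : (2 * ((j + 1 : ℕ) : ℝ) - 2) * Real.pi = (2 * j : ℕ) * Real.pi := by push_cast; ring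
  have r2 : 2 * ((j + 1 : ℕ) : ℝ) * Real.pi = ((2 * j : ℕ) + 2) * Real.pi := by push_cast; ring
  have r3 : (2 * ((j + 1 : ℕ) : ℝ) - 1) * Real.pi = (2 * j + 1 : ℕ) * Real.pi := by
    push_cast; ring
  have r4 : (2 * ((j + 1 : ℕ) : ℝ) + 1) * Real.pi = ((2 * j + 1 : ℕ) + 2) * Real.pi := by
    push_cast; ring
  rw [e1, e2, r1, r2, r3, r4]
  have hev : ((-1 : ℝ)) ^ (2 * j) = 1 := by rw [pow_mul]; simp
  have hod : ((-1 : ℝ)) ^ (2 * j + 1) = -1 := by rw [pow_succ, hev]; simp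
  refine ⟨fun h => ?_, fun h t ht => ?_, fun h => ?_, fun h => ?_, fun h => ?_, fun h => ?_,
    fun h t ht => ?_⟩
  · exact ⟨S.encard_meets hv htraj hx (c12 h).2.1, S.meets_eq_empty hv htraj hx (c12 h).2.2⟩
  · obtain ⟨h0, -, h2⟩ := c12 (Or.inl h)
    have hlow := c1 h (t - (2 * j : ℕ) * Real.pi) ⟨by linarith [ht.1], by linarith [ht.2]⟩
    rw [Duffing.view_sub, hev, one_mul] at hlow
    refine lt_min hlow ?_
    -- Even spikes reaching into the period are centred at its ends, where `u` is below `a` and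
    -- hence below the whole spike; elsewhere `f₊ = b > u`.
    unfold Duffing.fPlus
    split_ifs with hk'
    · obtain ⟨hpar, hmem⟩ := hk'.choose_spec
      have := S.view_lt_of_spikeDom hv htraj hx h0 h2 ht hmem
        (hpar.sub (by push_cast; exact even_two_mul _))
      rw [hev, one_mul] at this
      rwa [Duffing.spike, hpar.neg_one_zpow, one_mul]
    · exact (abs_lt.1 (hx t)).2
  · obtain ⟨s, hs1, hs2⟩ := c2 h
    refine ⟨s + (2 * j : ℕ) * Real.pi, ⟨by linarith [hs1.1], by linarith [hs1.2]⟩, ?_⟩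
    rw [Duffing.view, hev, one_mul] at hs2
    exact (min_le_left _ _).trans_lt hs2
  · exact ⟨S.meets_eq_empty hv htraj hx (c3 h).1, S.meets_eq_empty hv htraj hx (c3 h).2⟩
  · exact ⟨S.meets_eq_empty hv htraj hx (c45 h).1, S.encard_meets hv htraj hx (c45 h).2.1⟩
  · obtain ⟨s, hs1, hs2⟩ := c4 h
    refine ⟨s + (2 * j + 1 : ℕ) * Real.pi, ⟨by linarith [hs1.1], by linarith [hs1.2]⟩, ?_⟩
    rw [Duffing.view, hod] at hs2
    exact lt_of_lt_of_le (by linarith) (le_max_left _ _)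
  · obtain ⟨h0, -, h2⟩ := c45 (Or.inr h)
    have hlow := c5 h (t - (2 * j + 1 : ℕ) * Real.pi) ⟨by linarith [ht.1], by linarith [ht.2]⟩
    rw [Duffing.view_sub, hod] at hlow
    refine max_lt (by linarith) ?_
    -- The mirror image of the previous argument, with odd spikes at the ends of the period.
    unfold Duffing.fMinus
    split_ifs with hk'
    · obtain ⟨hpar, hmem⟩ := hk'.choose_spec
      have := S.view_lt_of_spikeDom hv htraj hx h0 h2 ht hmem
        (hpar.sub_odd (by push_cast; exact odd_two_mul_add_one _))
      rw [hod] at this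
      rw [Duffing.spike, hpar.neg_one_zpow]
      linarith
    · exact (abs_lt.1 (hx t)).1
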